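/- Let $\mathfrak g$ be a complex semisimple Lie algebra with Chevalley generators $e_i,f_i$ and Cartan subalgebra $\mathfrak h$, and let $G$ be the adjoint group of $\mathfrak g$, with maximal unipotent subgroup $U^+$ generated by the $x_i(t)=\exp(t\,\mathrm{ad}\,e_i)$, Cartan subgroup $T$, Borel subgroup $B^+=TU^+$, the lift $\overline w_0\in G$ of the longest Weyl group element obtained from a reduced word by lifting each simple reflection to $x_i(-1)y_i(1)x_i(-1)$, where $y_i(t)=\exp(t\,\mathrm{ad}\,f_i)$, and $B^-=\overline w_0B^+\overline w_0^{-1}$. A pinning is a pair $p\in G/U^+\times G/B^+$ of a decorated flag and a flag whose pair of underlying flags is in the $G$-orbit of $(B^+,B^-)$. The pinnings form a principal $G$-space with base point $p_{\mathrm{std}}=([U^+],B^-)$, and one puts $(g.p_{\mathrm{std}})^*:=g\overline w_0.p_{\mathrm{std}}$. A marked surface $\Sigma$ is a compact oriented surface, possibly disconnected, with a finite non-empty set of marked points which meets every boundary component; a boundary interval is a component of the boundary without the marked points, oriented as part of the boundary. Let $\mathcal P_{G,\Sigma}$ be the set of gauge equivalence classes $[\mathcal L,\beta;p]$ where $\mathcal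 L$ is a $G$-local system on $\Sigma$ without the marked points, $\beta$ is a flat section near the marked points of the associated bundle of flags, and $p$ is a flat section over the boundary intervals of the associated bundle of pinnings, such that over each boundary interval $E$ the section $p_E$ projects to the pair of flags given by $\beta$ near the initial and near the terminal endpoint of $E$. An arc class $[c]\colon E\to F$ is a homotopy class of paths from the boundary interval $E$ to the boundary interval $F$ in $\Sigma$ without the marked points, where the endpoints may move inside $E$ and $F$. The Wilson line $g_{[c]}\colon\mathcal P_{G,\Sigma}\to G$ is defined as follows: trivialize $\mathcal L$ near $E$ so that $p_E$ becomes $p_{\mathrm{std}}$, and extend the trivialization along $c$; then $p_F$ becomes $g_{[c]}([\mathcal L,\beta;p]).p_{\mathrm{std}}^*$. Let $E_2\neq E_2'$ be boundary intervals of $\Sigma$ and let $\Sigma'$ be the marked surface obtained from $\Sigma$ by gluing $E_2$ and $E_2'$ by an orientation reversing homeomorphism. The gluing map $q_{E_2,E_2'}\colon\mathcal P_{G,\Sigma}\to\mathcal P_{G,\Sigma'}$ glues $(\mathcal L,\beta;p)$ by the unique isomorphism between the restrictions of $\mathcal L$ near $E_2$ and $E_2'$ which identifies $p_{E_2}$ with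 $p_{E_2'}^*$. Let $E_1,E_3$ be boundary intervals of $\Sigma$ different from $E_2$ and $E_2'$, let $[c_1]\colon E_1\to E_2$ and $[c_2]\colon E_2'\to E_3$ be arc classes of $\Sigma$, and let $[c]\colon E_1\to E_3$ be the arc class of $\Sigma'$ which is their concatenation. Then $$q_{E_2,E_2'}^*\,g_{[c]}=g_{[c_1]}\cdot g_{[c_2]},$$ that is, $g_{[c]}(q_{E_2,E_2'}(x))=g_{[c_1]}(x)\,g_{[c_2]}(x)$ for all $x\in\mathcal P_{G,\Sigma}$. This holds both when the glued pieces lie in different components of $\Sigma$ and when they lie in the same component. -/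

import Mathlib

universe u

namespace WilsonLines

noncomputable section

set_option linter.unusedSectionVars false

open LieAlgebra LieAlgebra.IsKilling Module

section Words
variable {ι R M N : Type*} [Finite ι] [CommRing R] [IsDomain R] [CharZero R]
  [AddCommGroup M] [Module R M] [AddCommGroup N] [Module R N]
  {P : RootPairing ι R M N} [P.IsCrystallographic] [P.IsReduced] [P.IsRootSystem]
  (c : P.Base)

/-- The Weyl group element `r_{s₁} ⋯ r_{s_n}` of a word in the simple roots, acting on the
roots. -/
def wordPerm (l : List c.support) : Equiv.Perm ι :=
  (l.map fun s => P.reflectionPerm s).prod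

/-- A word in the simple reflections is reduced if no shorter word represents the same element. -/
def IsReducedWord (l : List c.support) : Prop :=
  ∀ l' : List c.support, wordPerm c l' = wordPerm c l → l.length ≤ l'.length

/-- A reduced word of the longest element `w₀` of the Weyl group. -/
structure IsLongestWord (l : List c.support) : Prop where
  reduced : IsReducedWord c l
  longest : ∀ l' : List c.support, IsReducedWord c l' → l'.length ≤ l.length

variable {c}

lemma wordPerm_nil : wordPerm c [] = 1 := rfl

lemma wordPerm_cons (s : c.support) (l : List c.support) :
    wordPerm c (s :: l) = P.reflectionPerm s * wordPerm c l := by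
  simp [wordPerm]

lemma wordPerm_append (l l' : List c.support) :
    wordPerm c (l ++ l') = wordPerm c l * wordPerm c l' := by
  simp [wordPerm]

lemma wordPerm_conj (l : List c.support) (i : ι) :
    P.reflectionPerm (wordPerm c l i) * wordPerm c l = wordPerm c l * P.reflectionPerm i := by
  induction l with
  | nil => simp [wordPerm_nil]
  | cons s l ih =>
    have key : ∀ j : ι, P.reflectionPerm (P.reflectionPerm s j) * P.reflectionPerm s
        = P.reflectionPerm s * P.reflectionPerm j := by
      intro j
      ext k
      apply P.root.injective
      simp [P.reflection_reflectionPerm, RootPairing.root_reflectionPerm]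
    rw [wordPerm_cons, Equiv.Perm.mul_apply, ← mul_assoc, key, mul_assoc, ih, mul_assoc]

lemma exists_reduced (l : List c.support) :
    ∃ l', IsReducedWord c l' ∧ wordPerm c l' = wordPerm c l := by
  classical
  have hex : ∃ n, ∃ l' : List c.support, l'.length = n ∧ wordPerm c l' = wordPerm c l :=
    ⟨_, l, rfl, rfl⟩
  obtain ⟨l', h1, h2⟩ := Nat.find_spec hex
  exact ⟨l', fun l'' h => h1 ▸ Nat.find_min' hex ⟨l'', rfl, h.trans h2⟩, h2⟩

/-- The exchange property. -/
lemma exchange (l : List c.support) (s : c.support) (h : ¬ c.IsPos (wordPerm c l s)) :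
    ∃ l' : List c.support, l'.length + 1 = l.length ∧
      wordPerm c l' = wordPerm c l * P.reflectionPerm s := by
  induction l with
  | nil => exact absurd (c.isPos_of_mem_support s.2) (by simpa [wordPerm_nil] using h)
  | cons t l ih =>
    by_cases hp : c.IsPos (wordPerm c l s)
    · have hst : wordPerm c l s = t := by
        by_contra hne
        exact h (by
          rw [wordPerm_cons, Equiv.Perm.mul_apply]
          exact hp.reflectionPerm t.2 hne)
      refine ⟨l, rfl, ?_⟩
      rw [wordPerm_cons, mul_assoc, ← wordPerm_conj, hst, ← mul_assoc, ← sq,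
        P.reflectionPerm_sq, one_mul]
    · obtain ⟨l', h1, h2⟩ := ih hp
      exact ⟨t :: l', by simp [h1], by rw [wordPerm_cons, wordPerm_cons, h2, mul_assoc]⟩

lemma IsLongestWord.not_isPos_simple {l : List c.support} (hl : IsLongestWord c l)
    (s : c.support) : ¬ c.IsPos (wordPerm c l s) := by
  intro hp
  obtain ⟨m, hm, hm'⟩ := exists_reduced (l ++ [s])
  have hms : wordPerm c m = wordPerm c l * P.reflectionPerm s := by
    rw [hm', wordPerm_append, wordPerm_cons, wordPerm_nil, mul_one]
  have hneg : ¬ c.IsPos (wordPerm c m s) := by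
    let := P.indexNeg
    have : wordPerm c m s = -(wordPerm c l s) := by
      have h2 := wordPerm_conj l (s : ι)
      rw [hms, ← h2]
      rfl
    rw [this]
    exact fun h => (RootPairing.Base.IsPos.neg_iff_not c _).1 h hp
  obtain ⟨m', h1, h2⟩ := exchange m s hneg
  have h3 : wordPerm c m' = wordPerm c l := by
    rw [h2, hms, mul_assoc, ← sq, P.reflectionPerm_sq, mul_one]
  have := hl.reduced m' h3
  have := hl.longest m hm
  lia

lemma exists_linear (l : List c.support) :
    ∃ W : M →ₗ[R] M, ∀ i, P.root (wordPerm c l i) = W (P.root i) := by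
  induction l with
  | nil => exact ⟨LinearMap.id, fun i => rfl⟩
  | cons s l ih =>
    obtain ⟨W, hW⟩ := ih
    refine ⟨(P.reflection s).toLinearMap ∘ₗ W, fun i => ?_⟩
    rw [wordPerm_cons, Equiv.Perm.mul_apply, RootPairing.root_reflectionPerm, hW]
    rfl

lemma wordPerm_neg (l : List c.support) (i : ι) :
    let := P.indexNeg
    wordPerm c l (-i) = -wordPerm c l i := by
  intro _
  obtain ⟨W, hW⟩ := exists_linear l
  apply P.root.injective
  have h1 : ∀ j : ι, P.root (-j) = - P.root j := fun j => by simp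
  rw [hW, h1, h1, map_neg, ← hW]

lemma not_isPos_of_simple {l : List c.support} (h : ∀ s : c.support, ¬ c.IsPos (wordPerm c l s))
    {i : ι} (hi : c.IsPos i) : ¬ c.IsPos (wordPerm c l i) := by
  refine hi.induction_on_add (p := fun i => ¬ c.IsPos (wordPerm c l i))
    (fun i hi => h ⟨i, hi⟩) ?_
  intro i j k hk h1 hj
  have h2 := h ⟨j, hj⟩
  obtain ⟨W, hW⟩ := exists_linear l
  have := c.height_add (i := wordPerm c l i) (j := wordPerm c l j) (k := wordPerm c l k)
    (by rw [hW, hk, map_add, ← hW, ← hW])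
  rw [RootPairing.Base.isPos_iff] at h1 h2 ⊢
  lia

lemma wordPerm_eq_one {l : List c.support} (h : ∀ i, c.IsPos i → c.IsPos (wordPerm c l i)) :
    wordPerm c l = 1 := by
  obtain ⟨m, hm, hm'⟩ := exists_reduced l
  rcases List.eq_nil_or_concat m with rfl | ⟨m', s, rfl⟩
  · rw [← hm', wordPerm_nil]
  · exfalso
    rw [List.concat_eq_append] at hm hm'
    have e : wordPerm c (m' ++ [s]) = wordPerm c m' * P.reflectionPerm s := by
      rw [wordPerm_append, wordPerm_cons, wordPerm_nil, mul_one]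
    have hneg : ¬ c.IsPos (wordPerm c m' s) := by
      let := P.indexNeg
      have h1 := h s (c.isPos_of_mem_support s.2)
      rw [← hm', e, ← wordPerm_conj] at h1
      have h2 : (P.reflectionPerm (wordPerm c m' s) * wordPerm c m') s = -(wordPerm c m' s) := rfl
      rw [h2, RootPairing.Base.IsPos.neg_iff_not] at h1
      exact h1
    obtain ⟨m'', h1, h2⟩ := exchange m' s hneg
    have := hm m'' (by rw [h2, e])
    simp at this
    lia

lemma IsLongestWord.wordPerm_mul_self {l : List c.support} (hl : IsLongestWord c l) :
    wordPerm c l * wordPerm c l = 1 := by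
  rw [← wordPerm_append]
  refine wordPerm_eq_one fun i hi => ?_
  let := P.indexNeg
  have h1 := not_isPos_of_simple hl.not_isPos_simple hi
  rw [← RootPairing.Base.IsPos.neg_iff_not] at h1
  have h2 := not_isPos_of_simple hl.not_isPos_simple h1
  rw [wordPerm_neg, RootPairing.Base.IsPos.neg_iff_not, not_not] at h2
  rwa [wordPerm_append]
end Words

section ExpAd
variable {𝔤 : Type u} [LieRing 𝔤] [LieAlgebra ℂ 𝔤]

/-- The underlying rational Lie algebra of a complex Lie algebra. -/
@[reducible] def ratLieAlgebra (𝔤 : Type u) [LieRing 𝔤] [LieAlgebra ℂ 𝔤] : LieAlgebra ℚ 𝔤 where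
  toModule := Module.compHom 𝔤 (algebraMap ℚ ℂ)
  lie_smul q x y := lie_smul (algebraMap ℚ ℂ q) x y

/-- The automorphism `exp (ad x)`, for an ad-nilpotent element `x`. -/
def expAd (x : 𝔤) (hx : IsNilpotent (ad ℂ 𝔤 x)) : 𝔤 ≃ₗ⁅ℂ⁆ 𝔤 :=
  let := ratLieAlgebra 𝔤
  LieDerivation.exp (LieDerivation.ad ℂ 𝔤 x) (by rwa [LieDerivation.coe_ad_apply_eq_ad_apply])

lemma expAd_apply (x : 𝔤) (hx : IsNilpotent (ad ℂ 𝔤 x)) {k : ℕ} {y : 𝔤}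
    (hk : ((ad ℂ 𝔤 x) ^ k) y = 0) :
    expAd x hx y = ∑ n ∈ Finset.range k, (n.factorial : ℂ)⁻¹ • ((ad ℂ 𝔤 x) ^ n) y := by
  let := ratLieAlgebra 𝔤
  have h : expAd x hx y = (IsNilpotent.exp (ad ℂ 𝔤 x)) • y := by
    rw [← LieDerivation.coe_ad_apply_eq_ad_apply]
    rfl
  rw [h, IsNilpotent.exp_smul_eq_sum (k := k) hk hx]
  refine Finset.sum_congr rfl fun n _ => ?_
  change (algebraMap ℚ ℂ (n.factorial : ℚ)⁻¹) • ((ad ℂ 𝔤 x) ^ n) y = _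
  simp

lemma expAd_neg_apply (x : 𝔤) (hx : IsNilpotent (ad ℂ 𝔤 x)) (hx' : IsNilpotent (ad ℂ 𝔤 (-x)))
    (y : 𝔤) : expAd (-x) hx' (expAd x hx y) = y := by
  let := ratLieAlgebra 𝔤
  have h : ∀ (z : 𝔤) (hz : IsNilpotent (ad ℂ 𝔤 z)) (y : 𝔤),
      expAd z hz y = (IsNilpotent.exp (ad ℂ 𝔤 z)) y := by
    intro z hz y
    rw [← LieDerivation.coe_ad_apply_eq_ad_apply]
    rfl
  rw [h, h, map_neg, ← Module.End.mul_apply, IsNilpotent.exp_neg_mul_exp_self hx,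
    Module.End.one_apply]

lemma ad_map_pow (φ : 𝔤 ≃ₗ⁅ℂ⁆ 𝔤) (x y : 𝔤) (n : ℕ) :
    ((ad ℂ 𝔤 (φ x)) ^ n) (φ y) = φ (((ad ℂ 𝔤 x) ^ n) y) := by
  induction n with
  | zero => simp
  | succ n ih => 
    rw [pow_succ', pow_succ', Module.End.mul_apply, Module.End.mul_apply, ih, ad_apply, ad_apply]
    exact (LieHom.map_lie φ.toLieHom _ _).symm

lemma isNilpotent_ad_map (φ : 𝔤 ≃ₗ⁅ℂ⁆ 𝔤) {x : 𝔤} (hx : IsNilpotent (ad ℂ 𝔤 x)) :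
    IsNilpotent (ad ℂ 𝔤 (φ x)) := by
  obtain ⟨k, hk⟩ := hx
  refine ⟨k, LinearMap.ext fun y => ?_⟩
  obtain ⟨y, rfl⟩ := φ.surjective y
  exact (ad_map_pow φ x y k).trans (by rw [hk]; simp)

lemma expAd_conj (φ : 𝔤 ≃ₗ⁅ℂ⁆ 𝔤) {x : 𝔤} (hx : IsNilpotent (ad ℂ 𝔤 x)) (y : 𝔤) :
    φ (expAd x hx y) = expAd (φ x) (isNilpotent_ad_map φ hx) (φ y) := by
  obtain ⟨k, hk⟩ := id hx
  rw [expAd_apply x hx (k := k) (by rw [hk]; rfl), expAd_apply (φ x) _ (k := k)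
    (by rw [ad_map_pow, hk]; simp), map_sum]
  exact Finset.sum_congr rfl fun n _ => by rw [map_smul, ad_map_pow]

/-- The eigenspaces of `ad σ` for integral eigenvalues. -/
def gradePiece (σ : 𝔤) (k : ℤ) : Submodule ℂ 𝔤 := Module.End.eigenspace (ad ℂ 𝔤 σ) (k : ℂ)

lemma mem_gradePiece {σ : 𝔤} {k : ℤ} {x : 𝔤} : x ∈ gradePiece σ k ↔ ⁅σ, x⁆ = (k : ℂ) • x := by
  simp [gradePiece]

/-- The property of raising the grading up to the identity. -/
def Raises (σ : 𝔤) (φ : 𝔤 → 𝔤) : Prop :=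
  ∀ k : ℤ, ∀ x ∈ gradePiece σ k, φ x - x ∈ ⨆ j : {j : ℤ // k < j}, gradePiece σ j

lemma expAd_raises {σ x : 𝔤} {m : ℤ} (hm : 0 < m) (hx : x ∈ gradePiece σ m)
    (hx' : IsNilpotent (ad ℂ 𝔤 x)) : Raises σ (expAd x hx') := by
  intro k y hy
  obtain ⟨n, hn⟩ := id hx'
  have key : ∀ r : ℕ, ((ad ℂ 𝔤 x) ^ r) y ∈ gradePiece σ (k + r * m) := by
    intro r
    induction r with
    | zero => simpa using hy
    | succ r ih =>
      rw [mem_gradePiece] at ih hx ⊢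
      rw [pow_succ', Module.End.mul_apply, ad_apply, leibniz_lie, hx, ih]
      simp only [smul_lie, lie_smul]
      push_cast
      module
  rw [expAd_apply x hx' (k := n + 1) (by rw [pow_succ, hn]; simp), Finset.sum_range_succ']
  simp only [Nat.factorial_zero, Nat.cast_one, inv_one, pow_zero, Module.End.one_apply, one_smul,
    add_sub_cancel_right]
  refine Submodule.sum_mem _ fun r _ => Submodule.smul_mem _ _ ?_
  exact Submodule.mem_iSup_of_mem (⟨k + (r + 1 : ℕ) * m, by push_cast; nlinarith⟩ : {j : ℤ // k < j})
    (key (r + 1))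

lemma Raises.apply_mem {σ : 𝔤} {φ : 𝔤 →ₗ[ℂ] 𝔤} (hφ : Raises σ φ) {k : ℤ} {x : 𝔤}
    (hx : x ∈ ⨆ j : {j : ℤ // k < j}, gradePiece σ j) :
    φ x ∈ ⨆ j : {j : ℤ // k < j}, gradePiece σ j := by
  induction hx using Submodule.iSup_induction' with
  | mem j y hy =>
    have h1 := hφ j y hy
    have h2 : (⨆ i : {i : ℤ // (j : ℤ) < i}, gradePiece σ i) ≤
        ⨆ j : {j : ℤ // k < j}, gradePiece σ j :=
      iSup_le fun i => le_iSup (fun j : {j : ℤ // k < j} => gradePiece σ j) ⟨i, j.2.trans i.2⟩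
    have h3 := Submodule.mem_iSup_of_mem (p := fun j : {j : ℤ // k < j} => gradePiece σ j) j hy
    simpa using add_mem (h2 h1) h3
  | zero => simp
  | add y z _ _ h1 h2 => rw [map_add]; exact add_mem h1 h2

lemma Raises.mul {σ : 𝔤} {φ ψ : 𝔤 →ₗ[ℂ] 𝔤} (hφ : Raises σ φ) (hψ : Raises σ ψ) :
    Raises σ (φ ∘ₗ ψ) := by
  intro k x hx
  have h1 := hφ.apply_mem (hψ k x hx)
  have h2 := hφ k x hx
  have : (φ ∘ₗ ψ) x - x = φ (ψ x - x) + (φ x - x) := by simp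
  rw [this]
  exact add_mem h1 h2

lemma gradePiece_neg (σ : 𝔤) (k : ℤ) : gradePiece (-σ) k = gradePiece σ (-k) := by
  ext x
  rw [mem_gradePiece, mem_gradePiece, neg_lie]
  push_cast
  rw [neg_smul, neg_eq_iff_eq_neg]

/-- A map which raises the grading agrees with the composite of a grading preserving map and a
lowering map only if it is the identity. -/
lemma eq_of_raises_of_lowers {σ : 𝔤} (hσ : ⨆ k : ℤ, gradePiece σ k = ⊤)
    {u t v : 𝔤 →ₗ[ℂ] 𝔤} (hu : Raises σ u) (ht : ∀ k, ∀ x ∈ gradePiece σ k, t x ∈ gradePiece σ k)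
    (hv : Raises (-σ) v) (h : u = t ∘ₗ v) : u = LinearMap.id := by
  have hind : iSupIndep (gradePiece σ) :=
    (Module.End.eigenspaces_iSupIndep (ad ℂ 𝔤 σ)).comp Int.cast_injective
  have ht' : ∀ k, ∀ x ∈ ⨆ j : {j : ℤ // j < k}, gradePiece σ j,
      t x ∈ ⨆ j : {j : ℤ // j < k}, gradePiece σ j := by
    intro k x hx
    induction hx using Submodule.iSup_induction' with
    | mem j y hy =>
      exact Submodule.mem_iSup_of_mem (p := fun j : {j : ℤ // j < k} => gradePiece σ j) j
        (ht j y hy)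
    | zero => simp
    | add y z _ _ h1 h2 => rw [map_add]; exact add_mem h1 h2
  have main : ∀ k, ∀ x ∈ gradePiece σ k, u x = x := by
    intro k x hx
    have h1 := hu k x hx
    have h2 := hv (-k) x (by rwa [gradePiece_neg, neg_neg])
    have h3 : (⨆ j : {j : ℤ // -k < j}, gradePiece (-σ) j) ≤
        ⨆ j : {j : ℤ // j < k}, gradePiece σ j := by
      refine iSup_le fun j => ?_
      rw [gradePiece_neg]
      exact le_iSup (fun j : {j : ℤ // j < k} => gradePiece σ j) ⟨-j, by have := j.2; lia⟩
    have h4 := ht' k _ (h3 h2)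
    have h5 : u x - x = t (v x - x) + (t x - x) := by rw [h]; simp
    have h6 : u x - x ∈ ⨆ j ∈ Set.Iic k, gradePiece σ j := by
      rw [h5]
      refine add_mem ?_ ?_
      · refine (iSup_le fun j => ?_ : (⨆ j : {j : ℤ // j < k}, gradePiece σ j) ≤ _) h4
        exact le_iSup₂_of_le (j : ℤ) j.2.le le_rfl
      · exact Submodule.mem_iSup_of_mem k (Submodule.mem_iSup_of_mem (Set.mem_Iic.2 le_rfl)
          (sub_mem (ht k x hx) hx))
    have h7 : u x - x ∈ ⨆ j ∈ Set.Ioi k, gradePiece σ j := by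
      refine (iSup_le fun j => ?_ : (⨆ j : {j : ℤ // k < j}, gradePiece σ j) ≤ _) h1
      exact le_iSup₂_of_le (j : ℤ) j.2 le_rfl
    have h8 := hind.disjoint_biSup_biSup (Set.disjoint_left.2 fun a h1 h2 => by
      simp only [Set.mem_Iic, Set.mem_Ioi] at h1 h2; lia : Disjoint (Set.Iic k) (Set.Ioi k))
    exact sub_eq_zero.1 (Submodule.disjoint_def.1 h8 _ h6 h7)
  ext x
  have hx : x ∈ ⨆ k : ℤ, gradePiece σ k := hσ ▸ Submodule.mem_top
  induction hx using Submodule.iSup_induction' with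
  | mem k x hx => exact main k x hx
  | zero => simp
  | add x y _ _ h1 h2 => rw [map_add, h1, h2, map_add]
end ExpAd

section Adjoint
open LieModule
variable {ι : Type*} [Fintype ι] {𝔤 : Type u} [LieRing 𝔤] [LieAlgebra ℂ 𝔤]
  [FiniteDimensional ℂ 𝔤] [LieAlgebra.IsKilling ℂ 𝔤] {H : LieSubalgebra ℂ 𝔤}
  [H.IsCartanSubalgebra] (b : LieAlgebra.Basis ι H)

lemma e_mem (i : ι) : b.e i ∈ rootSpace H (b.baseSupp i) :=
  (mem_genWeightSpace _ _ _).mpr fun z => ⟨1, by simp⟩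

lemma f_mem (i : ι) : b.f i ∈ rootSpace H (-b.baseSupp i : Dual ℂ H) :=
  (mem_genWeightSpace _ _ _).mpr fun z => ⟨1, by simp [← eq_neg_iff_add_eq_zero]⟩

lemma baseSupp_ne_zero (i : ι) : (b.baseSupp i : H → ℂ) ≠ 0 := fun h =>
  b.linearIndependent_baseSupp.ne_zero i (DFunLike.coe_injective h)

lemma isNilpotent_ad_e (i : ι) (t : ℂ) : IsNilpotent (ad ℂ 𝔤 (t • b.e i)) :=
  isNilpotent_ad_of_mem_rootSpace H (baseSupp_ne_zero b i)
    (Submodule.smul_mem _ t (e_mem b i))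

lemma isNilpotent_ad_f (i : ι) (t : ℂ) : IsNilpotent (ad ℂ 𝔤 (t • b.f i)) :=
  isNilpotent_ad_of_mem_rootSpace H
    (by simpa using baseSupp_ne_zero b i) (Submodule.smul_mem _ t (f_mem b i))

/-- The one-parameter subgroup `x_i(t) = exp (t ad e_i)`. -/
def rootX (i : ι) (t : ℂ) : 𝔤 ≃ₗ⁅ℂ⁆ 𝔤 := expAd (t • b.e i) (isNilpotent_ad_e b i t)

/-- The one-parameter subgroup `y_i(t) = exp (t ad f_i)`. -/
def rootY (i : ι) (t : ℂ) : 𝔤 ≃ₗ⁅ℂ⁆ 𝔤 := expAd (t • b.f i) (isNilpotent_ad_f b i t)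

/-- The adjoint group `G` of the semisimple Lie algebra `𝔤` with Chevalley generators `e_i, f_i`:
the group of automorphisms of `𝔤` generated by all `x_i(t)` and `y_i(t)`. -/
def AdjointGroup : Subgroup (𝔤 ≃ₗ[ℂ] 𝔤) :=
  Subgroup.closure ({g | ∃ i t, g = (rootX b i t).toLinearEquiv} ∪
    {g | ∃ i t, g = (rootY b i t).toLinearEquiv})

/-- `x_i(t)` as an element of `G`. -/
def xElt (i : ι) (t : ℂ) : AdjointGroup b :=
  ⟨_, Subgroup.subset_closure (Or.inl ⟨i, t, rfl⟩)⟩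

/-- `y_i(t)` as an element of `G`. -/
def yElt (i : ι) (t : ℂ) : AdjointGroup b :=
  ⟨_, Subgroup.subset_closure (Or.inr ⟨i, t, rfl⟩)⟩

/-- The maximal unipotent subgroup `U⁺`, generated by the simple root subgroups `x_i`. -/
def unipotent : Subgroup (AdjointGroup b) := Subgroup.closure {g | ∃ i t, g = xElt b i t}

/-- The Cartan subgroup: the elements of `G` which fix the Cartan subalgebra pointwise. -/
def cartan : Subgroup (AdjointGroup b) where
  carrier := {g | ∀ h ∈ H, (g : 𝔤 ≃ₗ[ℂ] 𝔤) h = h}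
  mul_mem' {g g'} hg hg' h hh := by
    change (g : 𝔤 ≃ₗ[ℂ] 𝔤) ((g' : 𝔤 ≃ₗ[ℂ] 𝔤) h) = h
    rw [hg' h hh, hg h hh]
  one_mem' h _ := rfl
  inv_mem' {g} hg h hh := (LinearEquiv.symm_apply_eq _).2 (hg h hh).symm

/-- The Borel subgroup `B⁺`, generated by the Cartan subgroup and `U⁺`. -/
def borel : Subgroup (AdjointGroup b) := cartan b ⊔ unipotent b

/-- The lift `φ_i (0 -1; 1 0) = x_i(-1) y_i(1) x_i(-1)` of the simple reflection `r_i`. -/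
def simpleLift (i : ι) : AdjointGroup b := xElt b i (-1) * yElt b i 1 * xElt b i (-1)

/-- The lift of a word in the simple reflections. -/
def wordLift (l : List ι) : AdjointGroup b := (l.map (simpleLift b)).prod

/-- A reduced word of the longest element of the Weyl group of `G`. -/
def IsLongest (l : List ι) : Prop := IsLongestWord b.base (l.map b.baseSupportEquiv)

lemma exists_lieEquiv (g : AdjointGroup b) : ∃ φ : 𝔤 ≃ₗ⁅ℂ⁆ 𝔤, (g : 𝔤 ≃ₗ[ℂ] 𝔤) = φ.toLinearEquiv := by
  obtain ⟨g, hg⟩ := g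
  induction hg using Subgroup.closure_induction with
  | mem g hg =>
    rcases hg with ⟨i, t, rfl⟩ | ⟨i, t, rfl⟩
    exacts [⟨_, rfl⟩, ⟨_, rfl⟩]
  | one => exact ⟨LieEquiv.refl, rfl⟩
  | mul g g' _ _ h h' =>
    obtain ⟨φ, h⟩ := h
    obtain ⟨φ', h'⟩ := h'
    refine ⟨φ'.trans φ, ?_⟩
    ext x
    simp only at h h'
    simp [h, h']
  | inv g _ h =>
    obtain ⟨φ, h⟩ := h
    refine ⟨φ.symm, ?_⟩
    exact congrArg (·⁻¹) h

lemma map_lie' (g : AdjointGroup b) (x y : 𝔤) :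
    (g : 𝔤 ≃ₗ[ℂ] 𝔤) ⁅x, y⁆ = ⁅(g : 𝔤 ≃ₗ[ℂ] 𝔤) x, (g : 𝔤 ≃ₗ[ℂ] 𝔤) y⁆ := by
  obtain ⟨φ, h⟩ := exists_lieEquiv b g
  rw [h]
  exact LieHom.map_lie φ.toLieHom x y

lemma mem_rootSpace_iff {χ : H → ℂ} {x : 𝔤} :
    x ∈ rootSpace H χ ↔ ∀ h : H, ⁅(h : 𝔤), x⁆ = χ h • x :=
  ⟨fun hx h => lie_eq_smul_of_mem_rootSpace hx h,
    fun hx => (mem_genWeightSpace _ _ _).mpr fun z => ⟨1, by simp [hx z]⟩⟩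

lemma simpleLift_apply (i : ι) (h : H) :
    (simpleLift b i : 𝔤 ≃ₗ[ℂ] 𝔤) (h : 𝔤) = (h : 𝔤) - b.baseSupp i h • b.h i := by
  have hs := b.sl2 i
  have hef : ⁅b.e i, b.f i⁆ = b.h i := hs.lie_e_f
  have hfe : ⁅b.f i, b.e i⁆ = - b.h i := by rw [← lie_skew, hef]
  have hhe : ⁅b.e i, b.h i⁆ = - (2 : ℂ) • b.e i := by
    rw [← lie_skew, hs.lie_h_e_smul ℂ, neg_smul]
  have hhf : ⁅b.f i, b.h i⁆ = (2 : ℂ) • b.f i := by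
    rw [← lie_skew, hs.lie_lie_smul_f ℂ, neg_neg]
  have hh : ∀ h : H, ⁅b.e i, (h : 𝔤)⁆ = - b.baseSupp i h • b.e i := by
    intro h
    rw [← lie_skew, ← LieSubalgebra.coe_bracket_of_module, ← b.baseSupp_apply_smul_e, neg_smul]
  have hf : ∀ h : H, ⁅b.f i, (h : 𝔤)⁆ = b.baseSupp i h • b.f i := by
    intro h
    rw [← lie_skew, ← LieSubalgebra.coe_bracket_of_module, ← b.baseSupp_apply_smul_f]
  have hx : ∀ h : H, rootX b i (-1) (h : 𝔤) = (h : 𝔤) + b.baseSupp i h • b.e i := by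
    intro h
    rw [rootX, expAd_apply (k := 2) _ _ (by simp [pow_two, hh, -LieAlgebra.Basis.baseSupp_apply_smul_e])]
    simp [Finset.sum_range_succ, hh, -LieAlgebra.Basis.baseSupp_apply_smul_e]
  have hee : rootX b i (-1) (b.e i) = b.e i := by
    rw [rootX, expAd_apply (k := 1) _ _ (by simp)]
    simp
  have hy : ∀ h : H, rootY b i 1 (h : 𝔤) = (h : 𝔤) + b.baseSupp i h • b.f i := by
    intro h
    rw [rootY, expAd_apply (k := 2) _ _ (by simp [pow_two, hf, -LieAlgebra.Basis.baseSupp_apply_smul_f])]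
    simp [Finset.sum_range_succ, hf, -LieAlgebra.Basis.baseSupp_apply_smul_f]
  have hye : rootY b i 1 (b.e i) = b.e i - b.h i - b.f i := by
    rw [rootY, expAd_apply (k := 3) _ _ (by simp [pow_succ, hfe, hhf])]
    simp [Finset.sum_range_succ, pow_succ, hfe, hhf, Nat.factorial]
    module
  have e1 : b.baseSupp i (b.h' i) = 2 := by
    have h1 := b.baseSupp_apply_smul_e i (b.h' i)
    rw [LieSubalgebra.coe_bracket_of_module] at h1
    exact smul_left_injective ℂ hs.e_ne_zero (h1.trans (hs.lie_h_e_smul ℂ))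
  have e2 : (b.h i : 𝔤) = (b.h' i : H) := rfl
  change rootX b i (-1) (rootY b i 1 (rootX b i (-1) (h : 𝔤))) = _
  rw [hx, map_add, map_smul, hy, hye]
  have e3 : (h : 𝔤) + b.baseSupp i h • b.f i + b.baseSupp i h • (b.e i - b.h i - b.f i)
    = h + b.baseSupp i h • b.e i - b.baseSupp i h • (b.h' i : 𝔤) := by
    rw [← e2]; module
  rw [e3, map_sub, map_add, map_smul, map_smul, hee, hx, hx, e1, ← e2]
  module
end Adjoint

section AdjointLaws
open LieModule
variable {ι : Type*} [Fintype ι] {𝔤 : Type u} [LieRing 𝔤] [LieAlgebra ℂ 𝔤]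
  [FiniteDimensional ℂ 𝔤] [LieAlgebra.IsKilling ℂ 𝔤] {H : LieSubalgebra ℂ 𝔤}
  [H.IsCartanSubalgebra] (b : LieAlgebra.Basis ι H)

lemma coe_mul_apply (g g' : AdjointGroup b) (x : 𝔤) :
    ((g * g' : AdjointGroup b) : 𝔤 ≃ₗ[ℂ] 𝔤) x = (g : 𝔤 ≃ₗ[ℂ] 𝔤) ((g' : 𝔤 ≃ₗ[ℂ] 𝔤) x) := rfl

lemma inv_coe_apply (g : AdjointGroup b) (x : 𝔤) :
    ((g⁻¹ : AdjointGroup b) : 𝔤 ≃ₗ[ℂ] 𝔤) ((g : 𝔤 ≃ₗ[ℂ] 𝔤) x) = x :=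
  (g : 𝔤 ≃ₗ[ℂ] 𝔤).symm_apply_apply x

lemma ext_coe {g g' : AdjointGroup b} (h : ∀ x, (g : 𝔤 ≃ₗ[ℂ] 𝔤) x = (g' : 𝔤 ≃ₗ[ℂ] 𝔤) x) :
    g = g' := Subtype.ext (LinearEquiv.ext h)

lemma map_mem_rootSpace (g : AdjointGroup b) {χ χ' : H → ℂ}
    (hg : ∀ h : H, ∃ h' : H, (g : 𝔤 ≃ₗ[ℂ] 𝔤) (h' : 𝔤) = h ∧ χ h' = χ' h) {x : 𝔤}
    (hx : x ∈ rootSpace H χ) : (g : 𝔤 ≃ₗ[ℂ] 𝔤) x ∈ rootSpace H χ' := by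
  rw [mem_rootSpace_iff] at hx ⊢
  intro h
  obtain ⟨h', h1, h2⟩ := hg h
  have h3 := hx h'
  rw [← h1, ← map_lie', h3, map_smul, h2]

lemma reflectionPerm_apply (i : ι) (β : H.root) (h : H) :
    ((rootSystem H).reflectionPerm (b.baseSupportEquiv i) β : H.root).1 h
      = β.1 h - b.baseSupp i h * β.1 (b.h' i) := by
  have h1 := (rootSystem H).root_reflectionPerm (b.baseSupportEquiv i) β
  rw [RootPairing.reflection_apply_root] at h1
  have h2 := LinearMap.congr_fun h1 h
  simp only [rootSystem_root_apply, rootSystem_pairing_apply, b.coroot_eq_h',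
    LinearMap.sub_apply, LinearMap.smul_apply, smul_eq_mul] at h2
  rw [mul_comm]
  exact h2

lemma simpleLift_mem_rootSpace (i : ι) (β : H.root) {x : 𝔤} (hx : x ∈ rootSpace H β.1) :
    (simpleLift b i : 𝔤 ≃ₗ[ℂ] 𝔤) x ∈
      rootSpace H ((rootSystem H).reflectionPerm (b.baseSupportEquiv i) β : H.root).1 := by
  refine map_mem_rootSpace b _ (fun h => ⟨h - b.baseSupp i h • b.h' i, ?_, ?_⟩) hx
  · have e1 : b.baseSupp i (b.h' i) = 2 := by
      have h1 := b.baseSupp_apply_smul_e i (b.h' i)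
      rw [LieSubalgebra.coe_bracket_of_module] at h1
      exact smul_left_injective ℂ (b.sl2 i).e_ne_zero (h1.trans ((b.sl2 i).lie_h_e_smul ℂ))
    rw [simpleLift_apply, map_sub, map_smul, e1]
    change (h : 𝔤) - b.baseSupp i h • b.h i - (b.baseSupp i h - b.baseSupp i h • (2 : ℂ)) • b.h i = _
    rw [smul_eq_mul]
    module
  · rw [reflectionPerm_apply]
    have : ∀ h : H, β.1 h = Weight.toLinear ℂ H 𝔤 β.1 h := fun _ => rfl
    simp only [this, map_sub, map_smul, smul_eq_mul]

lemma wordLift_mem_rootSpace (l : List ι) (β : H.root) {x : 𝔤} (hx : x ∈ rootSpace H β.1) :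
    (wordLift b l : 𝔤 ≃ₗ[ℂ] 𝔤) x ∈
      rootSpace H (wordPerm b.base (l.map b.baseSupportEquiv) β : H.root).1 := by
  induction l with
  | nil => exact hx
  | cons i l ih =>
    have h1 : wordLift b (i :: l) = simpleLift b i * wordLift b l := by simp [wordLift]
    rw [h1, coe_mul_apply, List.map_cons, wordPerm_cons, Equiv.Perm.mul_apply]
    exact simpleLift_mem_rootSpace b i _ ih

lemma wordLift_mem (l : List ι) {h : 𝔤} (hh : h ∈ H) : (wordLift b l : 𝔤 ≃ₗ[ℂ] 𝔤) h ∈ H := by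
  induction l with
  | nil => exact hh
  | cons i l ih =>
    have h1 : wordLift b (i :: l) = simpleLift b i * wordLift b l := by simp [wordLift]
    rw [h1, coe_mul_apply, simpleLift_apply b i ⟨_, ih⟩]
    exact H.sub_mem ih (H.smul_mem _ (b.h' i).2)

lemma cartan_mem_rootSpace {t : AdjointGroup b} (ht : t ∈ cartan b) {χ : H → ℂ} {x : 𝔤}
    (hx : x ∈ rootSpace H χ) : (t : 𝔤 ≃ₗ[ℂ] 𝔤) x ∈ rootSpace H χ :=
  map_mem_rootSpace b t (fun h => ⟨h, ht h h.2, rfl⟩) hx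

lemma conj_xElt (g : AdjointGroup b) (i : ι) (s : ℂ) (φ : 𝔤 ≃ₗ⁅ℂ⁆ 𝔤)
    (h : (g : 𝔤 ≃ₗ[ℂ] 𝔤) = φ.toLinearEquiv) (x : 𝔤) :
    ((g * xElt b i s * g⁻¹ : AdjointGroup b) : 𝔤 ≃ₗ[ℂ] 𝔤) x
      = expAd (φ (s • b.e i)) (isNilpotent_ad_map φ (isNilpotent_ad_e b i s)) x := by
  have h1 : ∀ y, (g : 𝔤 ≃ₗ[ℂ] 𝔤) y = φ y := fun y => by rw [h]; rfl
  obtain ⟨y, rfl⟩ := (g : 𝔤 ≃ₗ[ℂ] 𝔤).surjective x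
  rw [coe_mul_apply, coe_mul_apply, inv_coe_apply, h1, h1]
  exact expAd_conj φ (isNilpotent_ad_e b i s) y

lemma expAd_congr {x y : 𝔤} (h : x = y) (hx : IsNilpotent (ad ℂ 𝔤 x))
    (hy : IsNilpotent (ad ℂ 𝔤 y)) (z : 𝔤) : expAd x hx z = expAd y hy z := by
  subst h; rfl

lemma conj_mem_unipotent {t : AdjointGroup b} (ht : t ∈ cartan b) {u : AdjointGroup b}
    (hu : u ∈ unipotent b) : t * u * t⁻¹ ∈ unipotent b := by
  induction hu using Subgroup.closure_induction with
  | mem u hu =>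
    obtain ⟨i, s, rfl⟩ := hu
    have h1 : finrank ℂ (rootSpace H (b.baseSupportEquiv i : H.root).1) = 1 :=
      finrank_rootSpace_eq_one _ (by
        have := (b.baseSupportEquiv i : H.root).2
        exact (Finset.mem_filter.1 this).2)
    have h2 : b.e i ∈ rootSpace H (b.baseSupportEquiv i : H.root).1 := e_mem b i
    obtain ⟨c, hc⟩ := (finrank_eq_one_iff_of_nonzero' (⟨_, h2⟩ : rootSpace H _)
      (fun h => (b.sl2 i).e_ne_zero (congrArg Subtype.val h))).1 h1
      ⟨_, cartan_mem_rootSpace b ht h2⟩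
    have hc' : c • b.e i = (t : 𝔤 ≃ₗ[ℂ] 𝔤) (b.e i) := congrArg Subtype.val hc
    obtain ⟨φ, hφ⟩ := exists_lieEquiv b t
    have : t * xElt b i s * t⁻¹ = xElt b i (s * c) := by
      refine ext_coe b fun x => ?_
      rw [conj_xElt b t i s φ hφ]
      refine expAd_congr ?_ _ (isNilpotent_ad_e b i (s * c)) x
      rw [mul_smul, hc', hφ, map_smul]
      rfl
    rw [this]
    exact Subgroup.subset_closure ⟨i, _, rfl⟩
  | one => simp
  | mul u v _ _ h h' =>
    have : t * (u * v) * t⁻¹ = (t * u * t⁻¹) * (t * v * t⁻¹) := by group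
    rw [this]
    exact mul_mem h h'
  | inv u _ h =>
    have : t * u⁻¹ * t⁻¹ = (t * u * t⁻¹)⁻¹ := by group
    rw [this]
    exact inv_mem h

lemma mem_borel {g : AdjointGroup b} (hg : g ∈ borel b) :
    ∃ t ∈ cartan b, ∃ u ∈ unipotent b, g = t * u := by
  have hle : cartan b ≤ Subgroup.normalizer (unipotent b) := by
    intro t ht
    rw [Subgroup.mem_normalizer_iff]
    refine fun u => ⟨conj_mem_unipotent b ht, fun h => ?_⟩
    have := conj_mem_unipotent b (inv_mem ht) h
    have e : t⁻¹ * (t * u * t⁻¹) * t⁻¹⁻¹ = u := by group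
    rwa [e] at this
  have h : g ∈ ((cartan b ⊔ unipotent b : Subgroup _) : Set (AdjointGroup b)) := hg
  rw [Subgroup.coe_mul_of_left_le_normalizer_right _ _ hle] at h
  obtain ⟨t, ht, u, hu, rfl⟩ := h
  exact ⟨t, ht, u, hu, rfl⟩

lemma wordLift_sq_mem {l : List ι} (hl : IsLongest b l) :
    wordLift b l * wordLift b l ∈ cartan b := by
  intro h hh
  set w := wordLift b l * wordLift b l with hw
  have hwh : (w : 𝔤 ≃ₗ[ℂ] 𝔤) h ∈ H := wordLift_mem b l (wordLift_mem b l hh)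
  have key : ∀ α : Weight ℂ H 𝔤, α ⟨_, hwh⟩ = α ⟨h, hh⟩ := by
    intro α
    by_cases hα : α.IsZero
    · have : (α : H → ℂ) = 0 := hα
      rw [this]; rfl
    obtain ⟨x, hx, hx0⟩ := α.exists_ne_zero
    let β : H.root := ⟨α, by simpa using hα⟩
    have h2 : (w : 𝔤 ≃ₗ[ℂ] 𝔤) x ∈ rootSpace H α := by
      have := wordLift_mem_rootSpace b l _ (wordLift_mem_rootSpace b l β hx)
      rw [← Equiv.Perm.mul_apply, hl.wordPerm_mul_self] at this
      exact this
    have h3 := mem_rootSpace_iff.1 h2 ⟨_, hwh⟩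
    have h4 := mem_rootSpace_iff.1 hx ⟨h, hh⟩
    have h5 : ⁅(w : 𝔤 ≃ₗ[ℂ] 𝔤) h, (w : 𝔤 ≃ₗ[ℂ] 𝔤) x⁆ = α ⟨h, hh⟩ • (w : 𝔤 ≃ₗ[ℂ] 𝔤) x := by
      rw [← map_lie', h4, map_smul]
    exact smul_left_injective ℂ ((w : 𝔤 ≃ₗ[ℂ] 𝔤).map_ne_zero_iff.2 hx0) (h3.symm.trans h5)
  have h6 : (⟨_, hwh⟩ - ⟨h, hh⟩ : H) ∈ ⨅ α : Weight ℂ H 𝔤, α.ker := by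
    rw [Submodule.mem_iInf]
    intro α
    have : ∀ h : H, α h = Weight.toLinear ℂ H 𝔤 α h := fun _ => rfl
    rw [LinearMap.mem_ker, map_sub, ← this, ← this, key, sub_self]
  rw [iInf_ker_weight_eq_bot, Submodule.mem_bot, sub_eq_zero] at h6
  exact congrArg Subtype.val h6

lemma wordLift_inv_mem {l : List ι} (hl : IsLongest b l) {h : 𝔤} (hh : h ∈ H) :
    ((wordLift b l)⁻¹ : 𝔤 ≃ₗ[ℂ] 𝔤) h ∈ H := by
  have h1 := wordLift_sq_mem b hl h hh
  rw [coe_mul_apply] at h1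
  have h2 : ((wordLift b l)⁻¹ : 𝔤 ≃ₗ[ℂ] 𝔤) h = (wordLift b l : 𝔤 ≃ₗ[ℂ] 𝔤) h := by
    conv_lhs => rw [← h1]
    exact inv_coe_apply b _ _
  rw [h2]
  exact wordLift_mem b l hh

lemma exists_height : ∃ ρ : H, ∀ β : H.root, β.1 ρ = (b.base.height β : ℂ) := by
  let B := b.base.toWeightBasis
  obtain ⟨ρ, hρ⟩ := (Module.evalEquiv ℂ H).surjective (B.constr ℂ fun _ => (1 : ℂ))
  have h1 : ∀ f : Dual ℂ H, f ρ = B.constr ℂ (fun _ => (1 : ℂ)) f := fun f => by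
    rw [← hρ]; rfl
  refine ⟨ρ, fun β => ?_⟩
  obtain ⟨f, -, -, hf⟩ := b.base.exists_root_eq_sum_int β
  have h3 : ∀ j ∈ b.base.support, (rootSystem H).root j ρ = 1 := by
    intro j hj
    have h4 : (rootSystem H).root j = B ⟨j, hj⟩ := (b.base.toWeightBasis_apply ⟨j, hj⟩).symm
    rw [h4, h1, Basis.constr_basis]
  have h2 : β.1 ρ = (rootSystem H).root β ρ := rfl
  rw [RootPairing.Base.height_eq_sum hf, h2, hf]
  rw [Int.cast_sum, LinearMap.sum_apply]
  refine Finset.sum_congr rfl fun j hj => ?_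
  rw [LinearMap.smul_apply, h3 j hj]
  simp

lemma iSup_gradePiece {ρ : H} (hρ : ∀ β : H.root, β.1 ρ = (b.base.height β : ℂ)) :
    ⨆ k : ℤ, gradePiece (ρ : 𝔤) k = ⊤ := by
  have h1 := congrArg LieSubmodule.toSubmodule (LieModule.iSup_genWeightSpace_eq_top' ℂ H 𝔤)
  rw [LieSubmodule.iSup_toSubmodule, LieSubmodule.top_toSubmodule] at h1
  rw [eq_top_iff, ← h1]
  refine iSup_le fun α => ?_
  have h2 : ∃ k : ℤ, α ρ = k := by
    by_cases hα : α.IsZero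
    · have : (α : H → ℂ) = 0 := hα
      exact ⟨0, by rw [this]; simp⟩
    · exact ⟨_, hρ ⟨α, by simpa using hα⟩⟩
  obtain ⟨k, hk⟩ := h2
  refine le_iSup_of_le k fun x hx => ?_
  have h3 := mem_rootSpace_iff.1 hx ρ
  rw [mem_gradePiece, ← hk]
  exact h3

lemma raises_closure {σ : 𝔤} {S : Set (AdjointGroup b)}
    (h : ∀ s ∈ S, Raises σ (s : 𝔤 ≃ₗ[ℂ] 𝔤)) (h' : ∀ s ∈ S, s⁻¹ ∈ S) {u : AdjointGroup b}
    (hu : u ∈ Subgroup.closure S) : Raises σ (u : 𝔤 ≃ₗ[ℂ] 𝔤) := by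
  have : ∀ u ∈ Subgroup.closure S, Raises σ (u : 𝔤 ≃ₗ[ℂ] 𝔤) ∧
      Raises σ (u⁻¹ : AdjointGroup b).1 := by
    intro u hu
    induction hu using Subgroup.closure_induction with
    | mem u hu => exact ⟨h u hu, h _ (h' u hu)⟩
    | one =>
      have : Raises σ ((1 : AdjointGroup b) : 𝔤 ≃ₗ[ℂ] 𝔤) := fun k x _ => by
        change x - x ∈ _
        simp
      exact ⟨this, by rwa [inv_one]⟩
    | mul u v _ _ h h' =>
      refine ⟨Raises.mul (φ := (u : 𝔤 ≃ₗ[ℂ] 𝔤).toLinearMap) (ψ := (v : 𝔤 ≃ₗ[ℂ] 𝔤).toLinearMap)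
        h.1 h'.1, ?_⟩
      rw [mul_inv_rev]
      exact Raises.mul (φ := (v⁻¹ : AdjointGroup b).1.toLinearMap)
        (ψ := (u⁻¹ : AdjointGroup b).1.toLinearMap) h'.2 h.2
    | inv u _ h => exact ⟨h.2, by rw [inv_inv]; exact h.1⟩
  exact (this u hu).1

lemma xElt_inv (i : ι) (t : ℂ) : (xElt b i t)⁻¹ = xElt b i (-t) := by
  refine (eq_inv_of_mul_eq_one_left (ext_coe b fun x => ?_)).symm
  have h : (-t) • b.e i = -(t • b.e i) := neg_smul _ _
  have h' : IsNilpotent (ad ℂ 𝔤 (-(t • b.e i))) := h ▸ isNilpotent_ad_e b i (-t)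
  exact (expAd_congr h (isNilpotent_ad_e b i (-t)) h' _).trans (expAd_neg_apply _ (isNilpotent_ad_e b i t) h' x)

lemma unipotent_raises {ρ : H} (hρ : ∀ β : H.root, β.1 ρ = (b.base.height β : ℂ))
    {u : AdjointGroup b} (hu : u ∈ unipotent b) : Raises (ρ : 𝔤) (u : 𝔤 ≃ₗ[ℂ] 𝔤) := by
  refine raises_closure b ?_ ?_ hu
  · rintro _ ⟨i, t, rfl⟩
    refine expAd_raises one_pos ?_ (isNilpotent_ad_e b i t)
    have h1 := mem_rootSpace_iff.1 (e_mem b i) ρ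
    have h2 := hρ (b.baseSupportEquiv i)
    rw [RootPairing.Base.height_one_of_mem_support (b.baseSupportEquiv i).2] at h2
    have h3 : b.baseSupp i ρ = 1 := h2.trans (by simp)
    rw [mem_gradePiece, lie_smul, h1, h3]
    simp
  · rintro _ ⟨i, t, rfl⟩
    exact ⟨i, -t, xElt_inv b i t⟩

lemma unipotent_lowers {ρ : H} (hρ : ∀ β : H.root, β.1 ρ = (b.base.height β : ℂ)) {l : List ι}
    (hl : IsLongest b l) {u : AdjointGroup b} (hu : u ∈ unipotent b) :
    Raises (-ρ : 𝔤) ((wordLift b l * u * (wordLift b l)⁻¹ : AdjointGroup b) : 𝔤 ≃ₗ[ℂ] 𝔤) := by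
  set w := wordLift b l
  have h0 : w * u * w⁻¹ ∈ Subgroup.closure {g | ∃ i t, g = w * xElt b i t * w⁻¹} := by
    induction hu using Subgroup.closure_induction with
    | mem u hu =>
      obtain ⟨i, s, rfl⟩ := hu
      exact Subgroup.subset_closure ⟨i, s, rfl⟩
    | one => simp
    | mul u v _ _ h h' =>
      have : w * (u * v) * w⁻¹ = (w * u * w⁻¹) * (w * v * w⁻¹) := by group
      rw [this]
      exact mul_mem h h'
    | inv u _ h =>
      have : w * u⁻¹ * w⁻¹ = (w * u * w⁻¹)⁻¹ := by group
      rw [this]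
      exact inv_mem h
  refine raises_closure b ?_ ?_ h0
  · rintro _ ⟨i, t, rfl⟩
    obtain ⟨φ, hφ⟩ := exists_lieEquiv b w
    set γ : H.root := wordPerm b.base (l.map b.baseSupportEquiv) (b.baseSupportEquiv i : H.root)
    have h1 : (w : 𝔤 ≃ₗ[ℂ] 𝔤) (b.e i) ∈ rootSpace H γ.1 :=
      wordLift_mem_rootSpace b l (b.baseSupportEquiv i) (e_mem b i)
    have h2 : b.base.height γ < 0 := by
      have h3 := hl.not_isPos_simple (b.baseSupportEquiv i)
      rw [RootPairing.Base.isPos_iff'] at h3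
      exact not_le.1 h3
    have h4 := mem_rootSpace_iff.1 h1 ρ
    rw [hρ] at h4
    have h5 : φ (t • b.e i) ∈ gradePiece (-ρ : 𝔤) (-b.base.height γ) := by
      rw [gradePiece_neg, neg_neg, mem_gradePiece]
      have : φ (t • b.e i) = t • (w : 𝔤 ≃ₗ[ℂ] 𝔤) (b.e i) := by
        rw [hφ, map_smul]; rfl
      rw [this, lie_smul, h4, smul_comm]
    have h6 := expAd_raises (by lia) h5 (isNilpotent_ad_map φ (isNilpotent_ad_e b i t))
    intro k x hx
    have h7 := h6 k x hx
    rwa [← conj_xElt b w i t φ hφ] at h7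
  · rintro _ ⟨i, t, rfl⟩
    exact ⟨i, -t, by rw [← xElt_inv]; group⟩

lemma unipotent_inf_opposite {l : List ι} (hl : IsLongest b l) {u g : AdjointGroup b}
    (hu : u ∈ unipotent b) (hg : g ∈ borel b) (h : u = wordLift b l * g * (wordLift b l)⁻¹) :
    u = 1 := by
  set w := wordLift b l
  obtain ⟨ρ, hρ⟩ := exists_height b
  obtain ⟨t, ht, v, hv, rfl⟩ := mem_borel b hg
  have h1 : u = (w * t * w⁻¹) * (w * v * w⁻¹) := by rw [h]; group
  have h2 : ((u : 𝔤 ≃ₗ[ℂ] 𝔤) : 𝔤 →ₗ[ℂ] 𝔤) = LinearMap.id := by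
    refine eq_of_raises_of_lowers (iSup_gradePiece b hρ) (unipotent_raises b hρ hu)
      (t := ((w * t * w⁻¹ : AdjointGroup b) : 𝔤 ≃ₗ[ℂ] 𝔤))
      (v := ((w * v * w⁻¹ : AdjointGroup b) : 𝔤 ≃ₗ[ℂ] 𝔤)) ?_ (unipotent_lowers b hρ hl hv) ?_
    · intro k x hx
      rw [mem_gradePiece] at hx ⊢
      have h3 : ((w * t * w⁻¹ : AdjointGroup b) : 𝔤 ≃ₗ[ℂ] 𝔤) (ρ : 𝔤) = ρ := by
        rw [coe_mul_apply, coe_mul_apply]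
        refine (congrArg _ (ht _ (wordLift_inv_mem b hl ρ.2))).trans ?_
        exact (w : 𝔤 ≃ₗ[ℂ] 𝔤).apply_symm_apply _
      have h4 := map_lie' b (w * t * w⁻¹) ρ x
      rw [h3, hx, map_smul] at h4
      exact h4.symm
    · rw [h1]; rfl
  exact ext_coe b fun x => LinearMap.congr_fun h2 x

end AdjointLaws

section Pinnings

/-- A maximal unipotent subgroup `U`, a Borel subgroup `B` containing it, a Cartan subgroup `T` and
a lift `w` of the longest Weyl group element, with their elementary mutual relations. The datum used
for the adjoint group is `adjointDatum`. -/
structure FlagDatum (G : Type*) [Group G] where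
  U : Subgroup G
  B : Subgroup G
  T : Subgroup G
  w : G
  U_le : U ≤ B
  T_le : T ≤ B
  exists_eq_mul : ∀ g ∈ B, ∃ t ∈ T, ∃ u ∈ U, g = t * u
  conj_T : ∀ t ∈ T, w⁻¹ * t * w ∈ B
  conj_U : ∀ u ∈ U, w⁻¹ * u * w ∈ B → u = 1
  w_sq : w * w ∈ B

variable {G : Type*} [Group G] (D : FlagDatum G)

/-- The decorated flag variety `G / U⁺`. -/
abbrev DecFlag : Type _ := G ⧸ D.U

/-- The flag variety `G / B⁺`; the coset `g B⁺` stands for the Borel subgroup `g B⁺ g⁻¹`, so that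
`B⁻` is the class of `w̄₀`. -/
abbrev Flag : Type _ := G ⧸ D.B

/-- The flag which underlies a decorated flag. -/
def DecFlag.flag (A : DecFlag D) : Flag D := Subgroup.quotientMapOfLE D.U_le A

lemma DecFlag.flag_smul (g : G) (A : DecFlag D) :
    DecFlag.flag D (g • A) = g • DecFlag.flag D A := by
  induction A using QuotientGroup.induction_on with
  | H a => rfl

/-- A pair of flags is generic if it lies in the `G`-orbit of `(B⁺, B⁻)`. -/
def IsGeneric (F F' : Flag D) : Prop :=
  ∃ g : G, g • F = ((1 : G) : Flag D) ∧ g • F' = ((D.w : G) : Flag D)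

/-- A pinning: a decorated flag and a flag, with generic pair of underlying flags. -/
def Pinning : Type _ := {p : DecFlag D × Flag D // IsGeneric D (DecFlag.flag D p.1) p.2}

namespace Pinning
variable {D}

/-- The first underlying flag `π₊(p)`. -/
def fst (p : Pinning D) : Flag D := DecFlag.flag D p.1.1

/-- The second underlying flag `π₋(p)`. -/
def snd (p : Pinning D) : Flag D := p.1.2

instance : MulAction G (Pinning D) where
  smul g p := ⟨g • p.1, by
    obtain ⟨h, h1, h2⟩ := p.2
    refine ⟨h * g⁻¹, ?_, ?_⟩
    · rw [← h1, Prod.smul_fst, DecFlag.flag_smul, mul_smul, inv_smul_smul]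
    · rw [← h2, Prod.smul_snd, mul_smul, inv_smul_smul]⟩
  one_smul p := Subtype.ext (one_smul G p.1)
  mul_smul g h p := Subtype.ext (mul_smul g h p.1)

lemma fst_smul (g : G) (p : Pinning D) : (g • p).fst = g • p.fst := DecFlag.flag_smul D g p.1.1

lemma snd_smul (g : G) (p : Pinning D) : (g • p).snd = g • p.snd := rfl

variable (D) in
/-- The standard pinning `([U⁺], B⁻)`. -/
def std : Pinning D :=
  ⟨(((1 : G) : DecFlag D), ((D.w : G) : Flag D)), 1, by rw [one_smul]; rfl, by rw [one_smul]⟩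

lemma smul_std_inj {g h : G} (hgh : g • std D = h • std D) : g = h := by
  have h1 : ((g * 1 : G) : DecFlag D) = ((h * 1 : G) : DecFlag D) :=
    congrArg (fun p : Pinning D => p.1.1) hgh
  have h2 : ((g * D.w : G) : Flag D) = ((h * D.w : G) : Flag D) :=
    congrArg (fun p : Pinning D => p.1.2) hgh
  rw [QuotientGroup.eq] at h1 h2
  have h3 := D.conj_U (g⁻¹ * h) (by simpa using h1) (by simpa [mul_assoc] using h2)
  exact inv_mul_eq_one.1 h3

lemma exists_eq_smul (p : Pinning D) : ∃ g : G, p = g • std D := by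
  obtain ⟨⟨A, F⟩, g, h1, h2⟩ := p
  simp only at h1 h2
  induction A using QuotientGroup.induction_on with
  | H c =>
    have h1' : ((g * c : G) : Flag D) = ((1 : G) : Flag D) := h1
    rw [eq_comm, QuotientGroup.eq, inv_one, one_mul] at h1'
    obtain ⟨t, ht, u, hu, h3⟩ := D.exists_eq_mul _ h1'
    refine ⟨c * u⁻¹, Subtype.ext (Prod.ext ?_ ?_)⟩
    · change (c : DecFlag D) = ((c * u⁻¹ * 1 : G) : DecFlag D)
      rw [QuotientGroup.eq]
      simpa using hu
    · have h4 : c * u⁻¹ = g⁻¹ * t := by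
        rw [eq_inv_mul_iff_mul_eq, ← mul_assoc, h3, mul_inv_cancel_right]
      change F = ((c * u⁻¹ * D.w : G) : Flag D)
      rw [h4, mul_assoc, ← (MulAction.injective (α := G) g).eq_iff, h2]
      change _ = ((g * (g⁻¹ * (t * D.w)) : G) : Flag D)
      rw [mul_inv_cancel_left, QuotientGroup.eq, ← mul_assoc]
      exact D.conj_T t ht

/-- The pinnings form a principal `G`-set. -/
theorem existsUnique_eq_smul (p : Pinning D) : ∃! g : G, p = g • std D := by
  obtain ⟨g, hg⟩ := exists_eq_smul p
  exact ⟨g, hg, fun h hh => smul_std_inj (hh.symm.trans hg)⟩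

/-- The unique `g ∈ G` with `p = g . p_std`. -/
def elt (p : Pinning D) : G := (exists_eq_smul p).choose

lemma elt_smul_std (p : Pinning D) : p.elt • std D = p := (exists_eq_smul p).choose_spec.symm

/-- The opposite pinning: `p* = g w̄₀ . p_std` for `p = g . p_std`. -/
def opp (p : Pinning D) : Pinning D := (p.elt * D.w) • std D

lemma elt_smul (g : G) (p : Pinning D) : (g • p).elt = g * p.elt :=
  smul_std_inj (by rw [elt_smul_std, mul_smul, elt_smul_std])

lemma opp_smul (g : G) (p : Pinning D) : (g • p).opp = g • p.opp := by
  rw [opp, elt_smul, opp, mul_assoc, mul_smul]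

lemma fst_opp (p : Pinning D) : p.opp.fst = p.snd := by
  rw [opp, mul_smul, fst_smul]
  conv_rhs => rw [← elt_smul_std p, snd_smul]
  congr 1
  change ((D.w * 1 : G) : Flag D) = ((D.w : G) : Flag D)
  rw [mul_one]

lemma snd_opp (p : Pinning D) : p.opp.snd = p.fst := by
  rw [opp, mul_smul, snd_smul]
  conv_rhs => rw [← elt_smul_std p, fst_smul]
  congr 1
  change ((D.w * D.w : G) : Flag D) = ((1 : G) : Flag D)
  rw [eq_comm, QuotientGroup.eq, inv_one, one_mul]
  exact D.w_sq

lemma opp_injective : Function.Injective (opp (D := D)) := by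
  intro p q h
  have := smul_std_inj h
  rw [← elt_smul_std p, mul_right_cancel this, elt_smul_std]

lemma opp_surjective : Function.Surjective (opp (D := D)) := fun p =>
  ⟨(p.elt * D.w⁻¹) • std D, by
    have h : (std D).elt = 1 := smul_std_inj (by rw [elt_smul_std, one_smul])
    rw [opp, elt_smul, h, mul_one, inv_mul_cancel_right, elt_smul_std]⟩

lemma exists_smul_eq (p q : Pinning D) : ∃ g : G, g • p = q :=
  ⟨q.elt * p.elt⁻¹, by
    rw [mul_smul, inv_smul_eq_iff.2 (elt_smul_std p).symm, elt_smul_std]⟩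

lemma smul_inj {g h : G} {p : Pinning D} (hgh : g • p = h • p) : g = h := by
  have := congrArg elt hgh
  rw [elt_smul, elt_smul] at this
  exact mul_right_cancel this

end Pinning

open LieModule in
/-- The maximal unipotent, Borel and Cartan subgroups of the adjoint group, and the lift of the
longest Weyl group element. -/
def adjointDatum {ι : Type*} [Fintype ι] {𝔤 : Type u} [LieRing 𝔤] [LieAlgebra ℂ 𝔤]
    [FiniteDimensional ℂ 𝔤] [LieAlgebra.IsKilling ℂ 𝔤] {H : LieSubalgebra ℂ 𝔤}
    [H.IsCartanSubalgebra] (b : LieAlgebra.Basis ι H) {l : List ι} (hl : IsLongest b l) :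
    FlagDatum (AdjointGroup b) where
  U := unipotent b
  B := borel b
  T := cartan b
  w := wordLift b l
  U_le := le_sup_right
  T_le := le_sup_left
  exists_eq_mul g hg := mem_borel b hg
  conj_T t ht := le_sup_left (a := cartan b) (b := unipotent b) fun h hh => by
    change ((wordLift b l)⁻¹ : AdjointGroup b).1 (t.1 ((wordLift b l).1 h)) = h
    rw [ht _ (wordLift_mem b l hh)]
    exact inv_coe_apply b _ _
  conj_U u hu hg := unipotent_inf_opposite b hl hu hg (by group)
  w_sq := le_sup_left (a := cartan b) (b := unipotent b) (wordLift_sq_mem b hl)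

end Pinnings

open Set Filter Topology
open scoped Manifold ContDiff unitInterval

section Surfaces

/-- A marked surface: a compact oriented surface, possibly disconnected, with a non-empty finite set
of marked points which meets every boundary component. The orientation is given by an atlas whose
coordinate changes have positive Jacobian determinant. -/
structure MarkedSurface where
  carrier : Type u
  [top : TopologicalSpace carrier]
  [t2 : T2Space carrier]
  [compact : CompactSpace carrier]
  [charted : ChartedSpace (EuclideanHalfSpace 2) carrier]
  [smooth : IsManifold (𝓡∂ 2) ∞ carrier]
  oriented : ∀ φ ∈ atlas (EuclideanHalfSpace 2) carrier,
    ∀ ψ ∈ atlas (EuclideanHalfSpace 2) carrier, ∀ x ∈ (φ.symm.trans ψ).source,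
      0 < (fderivWithin ℝ ((𝓡∂ 2) ∘ (φ.symm.trans ψ) ∘ (𝓡∂ 2).symm) (range (𝓡∂ 2))
        ((𝓡∂ 2) x)).det
  marked : Set carrier
  marked_finite : marked.Finite
  marked_nonempty : marked.Nonempty
  marked_boundary : ∀ x ∈ (𝓡∂ 2).boundary carrier,
    (connectedComponentIn ((𝓡∂ 2).boundary carrier) x ∩ marked).Nonempty

attribute [instance] MarkedSurface.top MarkedSurface.t2 MarkedSurface.compact
  MarkedSurface.charted MarkedSurface.smooth

namespace MarkedSurface

/-- The complement of the marked points, over which the local systems live. It is homotopy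
equivalent to the surface obtained by removing small open disks around the punctures, and the ends
at the marked points play the role of the special points and of the new boundary circles. -/
def Punctured (S : MarkedSurface.{u}) : Type u := {x : S.carrier // x ∉ S.marked}

instance (S : MarkedSurface.{u}) : TopologicalSpace S.Punctured :=
  inferInstanceAs (TopologicalSpace {x : S.carrier // x ∉ S.marked})

instance (S : MarkedSurface.{u}) : T2Space S.Punctured :=
  inferInstanceAs (T2Space {x : S.carrier // x ∉ S.marked})

/-- The boundary of a marked surface, without the special points. -/
def bdry (S : MarkedSurface.{u}) : Set S.Punctured := {x | x.1 ∈ (𝓡∂ 2).boundary S.carrier}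

lemma isClosed_bdry (S : MarkedSurface.{u}) : IsClosed S.bdry :=
  IsClosed.preimage (f := fun x : S.Punctured => x.1) continuous_subtype_val
    ((𝓡∂ 2).isClosed_boundary (M := S.carrier) (n := ∞) (by simp))

/-- A parametrization `ℝ → ∂Σ` of a boundary interval, i.e. of a component of the boundary without
the special points, along the orientation induced from the surface: since the charts take values in
the half-plane `x₀ ≥ 0`, the coordinate `x₁` decreases. -/
structure IsOrientedParam (S : MarkedSurface.{u}) (e : ℝ → S.Punctured) : Prop where
  isEmbedding : IsEmbedding e
  range_eq : ∃ x ∈ S.bdry, range e = connectedComponentIn S.bdry x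
  exists_initial : ∃ m ∈ S.marked, Tendsto (fun t => (e t).1) atBot (𝓝 m)
  exists_terminal : ∃ m ∈ S.marked, Tendsto (fun t => (e t).1) atTop (𝓝 m)
  positive : ∀ φ ∈ atlas (EuclideanHalfSpace 2) S.carrier, ∀ t, (e t).1 ∈ φ.source →
    ∃ ε > 0, StrictAntiOn (fun s => (φ (e s).1).val 1) (Ioo (t - ε) (t + ε))

/-- A boundary interval of a marked surface, with an oriented parametrization. -/
structure BoundaryInterval (S : MarkedSurface.{u}) where
  param : ℝ → S.Punctured
  isOriented : S.IsOrientedParam param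

end MarkedSurface

open MarkedSurface

namespace MarkedSurface.BoundaryInterval
variable {S : MarkedSurface.{u}} (E : S.BoundaryInterval)

/-- The initial special point. -/
def initial : S.carrier := E.isOriented.exists_initial.choose

/-- The terminal special point. -/
def terminal : S.carrier := E.isOriented.exists_terminal.choose

lemma initial_mem : E.initial ∈ S.marked := E.isOriented.exists_initial.choose_spec.1

lemma terminal_mem : E.terminal ∈ S.marked := E.isOriented.exists_terminal.choose_spec.1

/-- The underlying subset of the surface. -/
def set : Set S.Punctured := range E.param

lemma continuous : Continuous E.param := E.isOriented.isEmbedding.continuous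

lemma injective : Function.Injective E.param := E.isOriented.isEmbedding.injective

lemma set_subset : E.set ⊆ S.bdry := by
  obtain ⟨x, -, h⟩ := E.isOriented.range_eq
  exact (subset_of_eq h).trans (connectedComponentIn_subset _ _)

lemma param_mem (t : ℝ) : E.param t ∈ S.bdry := E.set_subset ⟨t, rfl⟩

lemma isClosed_set : IsClosed E.set := by
  obtain ⟨x, hx, h⟩ := E.isOriented.range_eq
  rw [set, h]
  rw [connectedComponentIn_eq_image hx]
  exact isClosed_connectedComponent.trans S.isClosed_bdry

lemma isClosedEmbedding : IsClosedEmbedding E.param :=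
  ⟨E.isOriented.isEmbedding, E.isClosed_set⟩

end MarkedSurface.BoundaryInterval

end Surfaces

section LocalSystems
variable {G : Type u} [Group G] (D : FlagDatum G) (S : MarkedSurface.{u})

/-- A `G`-local system on `X`, as a principal bundle for the discrete group `G`: the total space is
the space of flat local trivializations, with its right action of `G`. -/
structure LocalSystem (G : Type u) [Group G] (X : Type u) [TopologicalSpace X] where
  total : Type u
  [top : TopologicalSpace total]
  [act : MulAction Gᵐᵒᵖ total]
  proj : total → X
  isCovering : IsQuotientCoveringMap proj Gᵐᵒᵖ

attribute [instance] LocalSystem.top LocalSystem.act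

open MulOpposite

/-- A framed `G`-local system with pinnings. Flat sections of the associated bundles `L ×_G (G / B⁺)`
and `L ×_G 𝒫` are given as equivariant locally constant functions on the total space of `L`: the
framing `β` near the marked points, the pinning `p` over the boundary intervals. Only these values
of `β` and `p` are meaningful. Over a boundary interval `p` projects to the pair of the flags given
by `β` near the initial and near the terminal special point. -/
structure FramedSystem extends LocalSystem G S.Punctured where
  β : total → Flag D
  p : total → Pinning D
  framing : ∃ U : Set S.carrier, IsOpen U ∧ S.marked ⊆ U ∧ ∀ l, (proj l).1 ∈ U →
    (∀ g : G, β (op g • l) = g⁻¹ • β l) ∧ ∀ᶠ l' in 𝓝 l, β l' = β l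
  p_smul : ∀ l, proj l ∈ S.bdry → ∀ g : G, p (op g • l) = g⁻¹ • p l
  p_const : ∀ l, proj l ∈ S.bdry → ∀ᶠ l' in 𝓝 l, proj l' ∈ S.bdry → p l' = p l
  compat : ∀ E : S.BoundaryInterval,
    (∀ᶠ t in atBot, ∀ l, proj l = E.param t → (p l).fst = β l) ∧
    (∀ᶠ t in atTop, ∀ l, proj l = E.param t → (p l).snd = β l)

variable {D S}

/-- An isomorphism of framed `G`-local systems with pinnings. -/
structure FramedIso (T T' : FramedSystem D S) where
  toHomeomorph : T.total ≃ₜ T'.total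
  map_smul : ∀ (g : G) l, toHomeomorph (op g • l) = op g • toHomeomorph l
  proj_eq : ∀ l, T'.proj (toHomeomorph l) = T.proj l
  β_eq : ∃ U : Set S.carrier, IsOpen U ∧ S.marked ⊆ U ∧ ∀ l, (T.proj l).1 ∈ U →
    T'.β (toHomeomorph l) = T.β l
  p_eq : ∀ l, T.proj l ∈ S.bdry → T'.p (toHomeomorph l) = T.p l

/-- The identity. -/
def FramedIso.refl (T : FramedSystem D S) : FramedIso T T where
  toHomeomorph := Homeomorph.refl _
  map_smul _ _ := rfl
  proj_eq _ := rfl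
  β_eq := ⟨univ, isOpen_univ, subset_univ _, fun _ _ => rfl⟩
  p_eq _ _ := rfl

/-- The inverse isomorphism. -/
def FramedIso.symm {T T' : FramedSystem D S} (F : FramedIso T T') : FramedIso T' T where
  toHomeomorph := F.toHomeomorph.symm
  map_smul g l := by
    rw [Homeomorph.symm_apply_eq, F.map_smul, Homeomorph.apply_symm_apply]
  proj_eq l := by rw [← F.proj_eq, Homeomorph.apply_symm_apply]
  β_eq := by
    obtain ⟨U, h1, h2, h3⟩ := F.β_eq
    refine ⟨U, h1, h2, fun l hl => ?_⟩
    rw [← h3, Homeomorph.apply_symm_apply]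
    rwa [← F.proj_eq, Homeomorph.apply_symm_apply]
  p_eq l hl := by
    rw [← F.p_eq, Homeomorph.apply_symm_apply]
    rwa [← F.proj_eq, Homeomorph.apply_symm_apply]

/-- The composite isomorphism. -/
def FramedIso.trans {T T' T'' : FramedSystem D S} (F : FramedIso T T') (F' : FramedIso T' T'') :
    FramedIso T T'' where
  toHomeomorph := F.toHomeomorph.trans F'.toHomeomorph
  map_smul g l := by simp [F.map_smul, F'.map_smul]
  proj_eq l := by simp [F.proj_eq, F'.proj_eq]
  β_eq := by
    obtain ⟨U, h1, h2, h3⟩ := F.β_eq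
    obtain ⟨U', h1', h2', h3'⟩ := F'.β_eq
    refine ⟨U ∩ U', h1.inter h1', subset_inter h2 h2', fun l hl => ?_⟩
    rw [Homeomorph.trans_apply, h3', h3 _ hl.1]
    rw [F.proj_eq]
    exact hl.2
  p_eq l hl := by
    rw [Homeomorph.trans_apply, F'.p_eq, F.p_eq _ hl]
    rwa [F.proj_eq]

variable (D S) in
/-- Gauge equivalence. -/
instance framedSetoid : Setoid (FramedSystem D S) where
  r T T' := Nonempty (FramedIso T T')
  iseqv := ⟨fun T => ⟨.refl T⟩, fun ⟨F⟩ => ⟨F.symm⟩, fun ⟨F⟩ ⟨F'⟩ => ⟨F.trans F'⟩⟩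

variable (D S) in
/-- The moduli space of framed `G`-local systems with pinnings: the set of gauge equivalence
classes. -/
def Moduli : Type (u + 1) := Quotient (framedSetoid D S)

end LocalSystems

section WilsonLine
variable {G : Type u} [Group G] {D : FlagDatum G} {S : MarkedSurface.{u}}
open MulOpposite

/-- A path from `E` to `F`. -/
def Arc (E F : S.BoundaryInterval) : Type u :=
  {γ : C(I, S.Punctured) // γ 0 ∈ E.set ∧ γ 1 ∈ F.set}

/-- Homotopy of paths from `E` to `F`, whose endpoints may move inside `E` and `F`. -/
instance arcSetoid (E F : S.BoundaryInterval) : Setoid (Arc E F) where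
  r γ γ' := ContinuousMap.HomotopicWith γ.1 γ'.1 fun γ => γ 0 ∈ E.set ∧ γ 1 ∈ F.set
  iseqv := ⟨fun γ => .refl γ.1 γ.2, fun h => h.symm, fun h h' => h.trans h'⟩

/-- An arc class `[c] : E → F`. -/
def ArcClass (E F : S.BoundaryInterval) : Type u := Quotient (arcSetoid E F)

/-- `g` is the value of the Wilson line along `γ`: a flat trivialization along `γ` for which the
pinning at the starting point is `p_std` yields the pinning `g . p_std^*` at the endpoint. -/
def IsWilson (T : FramedSystem D S) (γ : C(I, S.Punctured)) (g : G) : Prop :=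
  ∃ Γ : C(I, T.total), (∀ t, T.proj (Γ t) = γ t) ∧ T.p (Γ 0) = Pinning.std D ∧
    T.p (Γ 1) = g • (Pinning.std D).opp

lemma FramedSystem.proj_smul (T : FramedSystem D S) (g : Gᵐᵒᵖ) (l : T.total) :
    T.proj (g • l) = T.proj l := T.isCovering.map_smul g

lemma FramedSystem.exists_frame (T : FramedSystem D S) {x : S.Punctured} (hx : x ∈ S.bdry)
    (q : Pinning D) : ∃ l, T.proj l = x ∧ T.p l = q := by
  obtain ⟨l, rfl⟩ := T.isCovering.surjective x
  obtain ⟨g, hg⟩ := Pinning.exists_smul_eq (T.p l) q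
  refine ⟨op g⁻¹ • l, T.proj_smul _ l, ?_⟩
  rw [T.p_smul l hx, inv_inv, hg]

lemma FramedSystem.frame_unique (T : FramedSystem D S) {l l' : T.total}
    (h : T.proj l = T.proj l') (hl : T.proj l ∈ S.bdry) (hp : T.p l = T.p l') : l = l' := by
  obtain ⟨g, hg⟩ := T.isCovering.apply_eq_iff_mem_orbit.1 h
  simp only at hg
  have h1 : T.p l = (unop g)⁻¹ • T.p l' := by
    rw [← hg, ← T.p_smul l' (h ▸ hl), MulOpposite.op_unop]
  have h2 : (unop g)⁻¹ = 1 := Pinning.smul_inj (p := T.p l') (by rw [← h1, hp, one_smul])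
  have h3 : g = 1 := by
    rw [inv_eq_one] at h2
    exact unop_injective h2
  rw [← hg, h3, one_smul]

theorem existsUnique_isWilson (T : FramedSystem D S) {E F : S.BoundaryInterval} (γ : Arc E F) :
    ∃! g, IsWilson T γ.1 g := by
  have hcov : IsCoveringMap T.proj := T.isCovering.isCoveringMap
  obtain ⟨l, hl, hp⟩ := T.exists_frame (E.set_subset γ.2.1) (Pinning.std D)
  obtain ⟨Γ, h1, h2⟩ := hcov.exists_path_lifts γ.1 l hl.symm
  obtain ⟨g, hg⟩ := Pinning.exists_smul_eq (Pinning.std D).opp (T.p (Γ 1))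
  refine ⟨g, ⟨Γ, fun t => congrFun h1 t, by rw [h2, hp], hg.symm⟩, ?_⟩
  rintro g' ⟨Γ', h1', h2', h3'⟩
  have h0 : Γ' 0 = Γ 0 := by
    refine T.frame_unique ?_ ?_ (by rw [h2', h2, hp])
    · rw [h1']; exact (congrFun h1 0).symm
    · rw [h1']; exact E.set_subset γ.2.1
  have : (Γ' : I → T.total) = Γ := hcov.eq_of_comp_eq Γ'.continuous Γ.continuous
    (funext fun t => (h1' t).trans (congrFun h1 t).symm) 0 h0
  rw [this] at h3'
  exact Pinning.smul_inj (h3'.symm.trans hg.symm)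

/-- Constancy of the pinning along lifts of paths in the boundary. -/
lemma FramedSystem.p_path (T : FramedSystem D S) (Γ : C(I, T.total))
    (h : ∀ t, T.proj (Γ t) ∈ S.bdry) (t : I) : T.p (Γ t) = T.p (Γ 0) := by
  have : IsLocallyConstant fun t => T.p (Γ t) := by
    rw [IsLocallyConstant.iff_eventually_eq]
    intro s
    filter_upwards [Γ.continuous.continuousAt.eventually (T.p_const _ (h s))] with s' hs'
    exact hs' (h s')
  exact this.apply_eq_of_preconnectedSpace _ _

lemma IsWilson.of_iso {T T' : FramedSystem D S} (F : FramedIso T T') {E E' : S.BoundaryInterval}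
    {γ : Arc E E'} {g : G} (h : IsWilson T γ.1 g) : IsWilson T' γ.1 g := by
  obtain ⟨Γ, h1, h2, h3⟩ := h
  refine ⟨⟨F.toHomeomorph ∘ Γ, F.toHomeomorph.continuous.comp Γ.continuous⟩,
    fun t => (F.proj_eq _).trans (h1 t), ?_, ?_⟩
  · refine (F.p_eq _ ?_).trans h2
    rw [h1]; exact E.set_subset γ.2.1
  · refine (F.p_eq _ ?_).trans h3
    rw [h1]; exact E'.set_subset γ.2.2

lemma IsWilson.of_homotopic {T : FramedSystem D S} {E E' : S.BoundaryInterval}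
    {γ γ' : Arc E E'} (hγ : γ ≈ γ') {g : G} (h : IsWilson T γ.1 g) : IsWilson T γ'.1 g := by
  obtain ⟨Γ, h1, h2, h3⟩ := h
  obtain ⟨K⟩ := hγ
  have hcov : IsCoveringMap T.proj := T.isCovering.isCoveringMap
  have hK0 : ∀ a, K.toContinuousMap (0, a) = T.proj (Γ a) := fun a => by
    rw [h1]; exact K.apply_zero a
  set L := hcov.liftHomotopy K.toContinuousMap Γ hK0
  have hL : ∀ s t, T.proj (L (s, t)) = K (s, t) := fun s t =>
    congrFun (hcov.liftHomotopy_lifts K.toContinuousMap Γ hK0) (s, t)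
  have hL0 : ∀ t, L (0, t) = Γ t := hcov.liftHomotopy_zero K.toContinuousMap Γ hK0
  have key : ∀ t, (∀ s, K (s, t) ∈ S.bdry) → T.p (L (1, t)) = T.p (Γ t) := by
    intro t ht
    have := T.p_path (L.comp ((ContinuousMap.id I).prodMk (.const I t)))
      (fun s => by
        change T.proj (L (s, t)) ∈ _
        rw [hL]; exact ht s) 1
    rw [← hL0]
    exact this
  refine ⟨L.comp ((ContinuousMap.const I 1).prodMk (.id I)), fun t => ?_, ?_, ?_⟩
  · exact (hL 1 t).trans (K.apply_one t)
  · exact (key 0 fun s => E.set_subset (K.prop s).1).trans h2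
  · exact (key 1 fun s => E'.set_subset (K.prop s).2).trans h3

/-- The Wilson line of a framed system with pinnings along a path between boundary intervals. -/
def FramedSystem.wilson (T : FramedSystem D S) {E F : S.BoundaryInterval} (γ : Arc E F) : G :=
  (existsUnique_isWilson T γ).choose

lemma FramedSystem.wilson_spec (T : FramedSystem D S) {E F : S.BoundaryInterval} (γ : Arc E F) :
    IsWilson T γ.1 (T.wilson γ) := (existsUnique_isWilson T γ).choose_spec.1

/-- The Wilson line `g_[c] : 𝒫_{G,Σ} → G` along an arc class `[c] : E → F`. -/
def wilsonLine {E F : S.BoundaryInterval} (c : ArcClass E F) (x : Moduli D S) : G :=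
  Quotient.liftOn₂ c x (fun γ T => T.wilson γ) fun γ T γ' T' hγ ⟨F⟩ =>
    (existsUnique_isWilson T' γ').unique
      (((T.wilson_spec γ).of_homotopic hγ).of_iso F (γ := γ')) (T'.wilson_spec γ')

end WilsonLine

section Gluing
variable {S S' : MarkedSurface.{u}}

/-- The identification of two boundary intervals by an orientation reversing homeomorphism, with
the induced identification of their endpoints. The homeomorphism may be taken to be `t ↦ -t`, since
the oriented parametrizations of the boundary intervals are arbitrary. -/
inductive GlueRel (E E' : S.BoundaryInterval) : S.carrier → S.carrier → Prop
  | interval (t : ℝ) : GlueRel E E' (E.param t).1 (E'.param (-t)).1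
  | initial : GlueRel E E' E.initial E'.terminal
  | terminal : GlueRel E E' E.terminal E'.initial

/-- `S'` is the marked surface obtained from `S` by gluing the distinct boundary intervals `E` and
`E'`: the quotient of `S` by the identification of `E` with `E'`, with the images of the marked
points as marked points. The boundary of `S'` consists of the remaining part of the boundary of `S`,
and `S'` is oriented compatibly with `S`, that is, the induced orientations of the remaining
boundary intervals agree. -/
structure Gluing (S S' : MarkedSurface.{u}) (E E' : S.BoundaryInterval) where
  map : S.carrier → S'.carrier
  continuous_map : Continuous map
  surjective_map : Function.Surjective map
  disjoint : Disjoint E.set E'.set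
  map_eq_iff : ∀ x y, map x = map y ↔ Relation.EqvGen (GlueRel E E') x y
  marked_eq : S'.marked = map '' S.marked
  boundary_iff : ∀ x : S.Punctured, map x.1 ∈ (𝓡∂ 2).boundary S'.carrier ↔
    x ∈ S.bdry ∧ x ∉ E.set ∧ x ∉ E'.set
  oriented_iff : ∀ (e : ℝ → S.Punctured) (e' : ℝ → S'.Punctured),
    (∀ t, e t ∉ E.set ∧ e t ∉ E'.set) → (∀ t, (e' t).1 = map (e t).1) →
      (S.IsOrientedParam e ↔ S'.IsOrientedParam e')

namespace Gluing
variable {E E' : S.BoundaryInterval} (P : Gluing S S' E E')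

lemma eqvGen_cases (hd : Disjoint E.set E'.set) {x y : S.carrier}
    (h : Relation.EqvGen (GlueRel E E') x y) :
    x = y ∨ (x ∈ S.marked ∧ y ∈ S.marked) ∨
      ∃ t, (x = (E.param t).1 ∧ y = (E'.param (-t)).1) ∨
        (y = (E.param t).1 ∧ x = (E'.param (-t)).1) := by
  have hinj : ∀ s t, (E.param s).1 = (E.param t).1 → s = t := fun s t h =>
    E.injective (Subtype.ext h)
  have hinj' : ∀ s t, (E'.param s).1 = (E'.param t).1 → s = t := fun s t h =>
    E'.injective (Subtype.ext h)
  have hne : ∀ s t, (E.param s).1 ≠ (E'.param t).1 := fun s t h =>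
    Set.disjoint_left.1 hd ⟨s, rfl⟩ ⟨t, (Subtype.ext h).symm⟩
  induction h with
  | rel x y h =>
    cases h with
    | interval t => exact .inr (.inr ⟨t, .inl ⟨rfl, rfl⟩⟩)
    | initial => exact .inr (.inl ⟨E.initial_mem, E'.terminal_mem⟩)
    | terminal => exact .inr (.inl ⟨E.terminal_mem, E'.initial_mem⟩)
  | refl x => exact .inl rfl
  | symm x y _ ih =>
    rcases ih with rfl | h | ⟨t, h⟩
    · exact .inl rfl
    · exact .inr (.inl h.symm)
    · exact .inr (.inr ⟨t, h.symm⟩)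
  | trans x y z _ _ ih ih' =>
    rcases ih with rfl | h | ⟨t, ⟨rfl, rfl⟩ | ⟨rfl, rfl⟩⟩
    · exact ih'
    · rcases ih' with rfl | h' | ⟨s, ⟨rfl, rfl⟩ | ⟨rfl, rfl⟩⟩
      · exact .inr (.inl h)
      · exact .inr (.inl ⟨h.1, h'.2⟩)
      · exact absurd h.2 (E.param s).2
      · exact absurd h.2 (E'.param _).2
    · rcases ih' with rfl | h' | ⟨s, ⟨h1, rfl⟩ | ⟨rfl, h2⟩⟩
      · exact .inr (.inr ⟨t, .inl ⟨rfl, rfl⟩⟩)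
      · exact absurd h'.1 (E'.param _).2
      · exact absurd h1.symm (hne _ _)
      · have := neg_injective (hinj' _ _ h2)
        subst this
        exact .inl rfl
    · rcases ih' with rfl | h' | ⟨s, ⟨h1, rfl⟩ | ⟨rfl, h2⟩⟩
      · exact .inr (.inr ⟨t, .inr ⟨rfl, rfl⟩⟩)
      · exact absurd h'.1 (E.param _).2
      · have := hinj _ _ h1
        subst this
        exact .inl rfl
      · exact absurd h2 (hne _ _)

lemma mem_marked_iff (x : S.carrier) : P.map x ∈ S'.marked ↔ x ∈ S.marked := by
  rw [P.marked_eq]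
  refine ⟨?_, fun h => ⟨x, h, rfl⟩⟩
  rintro ⟨y, hy, h⟩
  rcases eqvGen_cases P.disjoint ((P.map_eq_iff y x).1 h) with
    rfl | h | ⟨t, ⟨rfl, rfl⟩ | ⟨rfl, rfl⟩⟩
  · exact hy
  · exact h.2
  · exact absurd hy (E.param t).2
  · exact absurd hy (E'.param _).2

/-- The gluing map on the complements of the marked points. -/
def mapP (x : S.Punctured) : S'.Punctured := ⟨P.map x.1, fun h => x.2 ((P.mem_marked_iff _).1 h)⟩

lemma mapP_glue (t : ℝ) : P.mapP (E.param t) = P.mapP (E'.param (-t)) :=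
  Subtype.ext ((P.map_eq_iff _ _).2 (.rel _ _ (.interval t)))

lemma mapP_eq {x y : S.Punctured} (h : P.mapP x = P.mapP y) :
    x = y ∨ ∃ t, (x = E.param t ∧ y = E'.param (-t)) ∨ (y = E.param t ∧ x = E'.param (-t)) := by
  rcases eqvGen_cases P.disjoint ((P.map_eq_iff x.1 y.1).1 (congrArg Subtype.val h)) with
    h | h | ⟨t, ⟨h1, h2⟩ | ⟨h1, h2⟩⟩
  · exact .inl (Subtype.ext h)
  · exact absurd h.1 x.2
  · exact .inr ⟨t, .inl ⟨Subtype.ext h1, Subtype.ext h2⟩⟩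
  · exact .inr ⟨t, .inr ⟨Subtype.ext h1, Subtype.ext h2⟩⟩

lemma isClosedMap_map : IsClosedMap P.map := P.continuous_map.isClosedMap

lemma continuous_mapP : Continuous P.mapP :=
  Continuous.subtype_mk (P.continuous_map.comp continuous_subtype_val) _

lemma surjective_mapP : Function.Surjective P.mapP := by
  rintro ⟨y, hy⟩
  obtain ⟨x, rfl⟩ := P.surjective_map y
  exact ⟨⟨x, fun h => hy ((P.mem_marked_iff x).2 h)⟩, rfl⟩

lemma isQuotientMap_mapP : IsQuotientMap P.mapP := by
  refine IsClosedMap.isQuotientMap ?_ P.continuous_mapP P.surjective_mapP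
  intro C hC
  obtain ⟨K, hK, rfl⟩ := isClosed_induced_iff.1 hC
  refine isClosed_induced_iff.2 ⟨P.map '' K, P.isClosedMap_map K hK, ?_⟩
  ext ⟨y, hy⟩
  constructor
  · rintro ⟨x, hx, rfl⟩
    exact ⟨⟨x, fun h => hy ((P.mem_marked_iff x).2 h)⟩, hx, rfl⟩
  · rintro ⟨x, hx, h⟩
    exact ⟨x.1, hx, congrArg Subtype.val h⟩

lemma mem_bdry_iff {x : S.Punctured} :
    P.mapP x ∈ S'.bdry ↔ x ∈ S.bdry ∧ x ∉ E.set ∧ x ∉ E'.set := P.boundary_iff x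

/-- The open subset of `S'` corresponding to a neighbourhood of the marked points of `S`. -/
lemma exists_region {U : Set S.carrier} (hU : IsOpen U) (hm : S.marked ⊆ U) :
    ∃ U' : Set S'.carrier, IsOpen U' ∧ S'.marked ⊆ U' ∧ ∀ x, P.map x ∈ U' → x ∈ U := by
  refine ⟨(P.map '' Uᶜ)ᶜ, (P.isClosedMap_map _ hU.isClosed_compl).isOpen_compl, ?_, ?_⟩
  · rintro y hy ⟨x, hx, rfl⟩
    exact hx (hm ((P.mem_marked_iff x).1 hy))
  · intro x hx
    by_contra h
    exact hx ⟨x, h, rfl⟩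

end Gluing
end Gluing

section GlueSystem
variable {G : Type u} [Group G] {D : FlagDatum G} {S S' : MarkedSurface.{u}}
  {E E' : S.BoundaryInterval} (P : Gluing S S' E E') (T : FramedSystem D S)
open MulOpposite

namespace Gluing

/-- The points `l` over `E` and `m` over `E'` are matched if they lie over identified points and the
isomorphism given by `l ↦ m` identifies the pinning `p_E` with `p_{E'}^*`. -/
def Matched (E E' : S.BoundaryInterval) (T : FramedSystem D S) (l m : T.total) : Prop :=
  ∃ t, T.proj l = E.param t ∧ T.proj m = E'.param (-t) ∧ T.p l = (T.p m).opp

variable {T} in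
lemma Matched.right_unique {l m m' : T.total} (h : Matched E E' T l m) (h' : Matched E E' T l m') :
    m = m' := by
  obtain ⟨t, h1, h2, h3⟩ := h
  obtain ⟨t', h1', h2', h3'⟩ := h'
  have := E.injective (h1.symm.trans h1')
  subst this
  exact T.frame_unique (h2.trans h2'.symm) (h2 ▸ E'.param_mem _)
    (Pinning.opp_injective (h3.symm.trans h3'))

variable {T} in
lemma Matched.left_unique {l l' m : T.total} (h : Matched E E' T l m) (h' : Matched E E' T l' m) :
    l = l' := by
  obtain ⟨t, h1, h2, h3⟩ := h
  obtain ⟨t', h1', h2', h3'⟩ := h'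
  have := neg_injective (E'.injective (h2.symm.trans h2'))
  subst this
  exact T.frame_unique (h1.trans h1'.symm) (h1 ▸ E.param_mem _) (h3.trans h3'.symm)

variable {T} in
lemma Matched.smul {l m : T.total} (h : Matched E E' T l m) (g : Gᵐᵒᵖ) :
    Matched E E' T (g • l) (g • m) := by
  obtain ⟨t, h1, h2, h3⟩ := h
  refine ⟨t, by rw [T.proj_smul, h1], by rw [T.proj_smul, h2], ?_⟩
  have e1 := T.p_smul l (h1 ▸ E.param_mem _) (unop g)
  have e2 := T.p_smul m (h2 ▸ E'.param_mem _) (unop g)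
  rw [MulOpposite.op_unop] at e1 e2
  rw [e1, e2, h3, Pinning.opp_smul]

variable {T} in
lemma Matched.false (hd : Disjoint E.set E'.set) {l m n : T.total} (h : Matched E E' T l m) (h' : Matched E E' T m n) :
    False := by
  obtain ⟨t, -, h2, -⟩ := h
  obtain ⟨t', h1', -, -⟩ := h'
  exact Set.disjoint_left.1 hd ⟨t', h1'.symm⟩ ⟨-t, h2.symm⟩

/-- The identification of the matched points. -/
def glueSetoid : Setoid T.total where
  r l m := l = m ∨ Matched E E' T l m ∨ Matched E E' T m l
  iseqv := by
    refine ⟨fun l => .inl rfl, ?_, ?_⟩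
    · rintro l m (rfl | h | h)
      exacts [.inl rfl, .inr (.inr h), .inr (.inl h)]
    · rintro l m n (rfl | h | h) (rfl | h' | h')
      · exact .inl rfl
      · exact .inr (.inl h')
      · exact .inr (.inr h')
      · exact .inr (.inl h)
      · exact (h.false P.disjoint h').elim
      · exact .inl (h.left_unique h')
      · exact .inr (.inr h)
      · exact .inl (h.right_unique h')
      · exact (h'.false P.disjoint h).elim

/-- The total space of the glued local system. -/
def GlueTotal : Type u := Quotient (P.glueSetoid T)

instance : TopologicalSpace (P.GlueTotal T) :=
  inferInstanceAs (TopologicalSpace (Quotient (P.glueSetoid T)))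

/-- The quotient map. -/
def glueMk (l : T.total) : P.GlueTotal T := Quotient.mk (P.glueSetoid T) l

lemma isQuotientMap_glueMk : IsQuotientMap (P.glueMk T) := isQuotientMap_quotient_mk'

variable {T} in
lemma glueMk_eq {l m : T.total} :
    P.glueMk T l = P.glueMk T m ↔ l = m ∨ Matched E E' T l m ∨ Matched E E' T m l :=
  Quotient.eq (r := P.glueSetoid T)

/-- A point of the total space which represents `q`. -/
def rep (q : P.GlueTotal T) : T.total := Quotient.out (s := P.glueSetoid T) q

lemma glueMk_rep (q : P.GlueTotal T) : P.glueMk T (P.rep T q) = q := Quotient.out_eq (s := P.glueSetoid T) q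

lemma glueMk_surjective : Function.Surjective (P.glueMk T) := fun q => ⟨_, P.glueMk_rep T q⟩

instance : MulAction Gᵐᵒᵖ (P.GlueTotal T) where
  smul g := Quotient.map (g • ·) (by
    rintro l m (rfl | h | h)
    exacts [.inl rfl, .inr (.inl (h.smul g)), .inr (.inr (h.smul g))])
  one_smul q := by
    obtain ⟨l, rfl⟩ := P.glueMk_surjective T q
    exact congrArg (P.glueMk T) (one_smul _ l)
  mul_smul g h q := by
    obtain ⟨l, rfl⟩ := P.glueMk_surjective T q
    exact congrArg (P.glueMk T) (mul_smul g h l)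

lemma smul_glueMk (g : Gᵐᵒᵖ) (l : T.total) : g • P.glueMk T l = P.glueMk T (g • l) := rfl

/-- The projection of the glued local system. -/
def glueProj (q : P.GlueTotal T) : S'.Punctured :=
  Quotient.liftOn q (fun l => P.mapP (T.proj l)) (by
    rintro l m (rfl | ⟨t, h1, h2, -⟩ | ⟨t, h1, h2, -⟩)
    · rfl
    · rw [h1, h2, P.mapP_glue]
    · rw [h1, h2, P.mapP_glue])

lemma glueProj_glueMk (l : T.total) : P.glueProj T (P.glueMk T l) = P.mapP (T.proj l) := rfl

variable {T} in
lemma exists_free (hd : Disjoint E.set E'.set) {l m : T.total} (h : Matched E E' T l m) :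
    ∃ W : Set T.total, IsOpen W ∧ l ∈ W ∧ m ∈ W ∧ (∀ x y, Matched E E' T x y → (x ∈ W ↔ y ∈ W)) ∧
      ∀ (g : Gᵐᵒᵖ) x, x ∈ W → g • x ∈ W → g = 1 := by
  obtain ⟨t, h1, h2, h3⟩ := h
  have hcov : IsCoveringMap T.proj := T.isCovering.isCoveringMap
  have hne : T.proj l ≠ T.proj m := fun h => Set.disjoint_left.1 hd ⟨t, h1.symm⟩
    ⟨-t, (h.trans h2).symm⟩
  obtain ⟨O, O', hO, hO', hlO, hmO', hOO'⟩ := t2_separation hne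
  have key : ∀ (l : T.total) (O : Set S.Punctured) (F : S.BoundaryInterval), IsOpen O →
      T.proj l ∈ O → T.proj l ∈ S.bdry → T.proj l ∉ F.set →
      ∃ V : Set T.total, IsOpen V ∧ l ∈ V ∧ (∀ x ∈ V, T.proj x ∈ O ∧ T.proj x ∉ F.set) ∧
      (∀ x ∈ V, T.proj x ∈ S.bdry → T.p x = T.p l) ∧
      (∀ (g : Gᵐᵒᵖ) x, x ∈ V → g • x ∈ V → g = 1) := by
    intro l O F hO hlO hl hlF
    obtain ⟨V0, hV0, hfree⟩ := T.isCovering.disjoint l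
    have hev : ∀ᶠ x in 𝓝 l, x ∈ V0 ∧ T.proj x ∈ O ∩ F.setᶜ ∧
        (T.proj x ∈ S.bdry → T.p x = T.p l) :=
      Filter.Eventually.and hV0 (Filter.Eventually.and
        (hcov.continuous.continuousAt.eventually
          ((hO.inter F.isClosed_set.isOpen_compl).mem_nhds ⟨hlO, hlF⟩)) (T.p_const l hl))
    obtain ⟨V, hV, hVo, hlV⟩ := eventually_nhds_iff.1 hev
    exact ⟨V, hVo, hlV, fun x hx => (hV x hx).2.1, fun x hx => (hV x hx).2.2,
      fun g x hx hgx => hfree g ⟨g • x, ⟨x, (hV x hx).1, rfl⟩, (hV _ hgx).1⟩⟩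
  obtain ⟨V, hVo, hlV, hV1, hV2, hV3⟩ := key l O E' hO hlO (h1 ▸ E.param_mem _)
    (fun h => Set.disjoint_left.1 hd ⟨t, h1.symm⟩ h)
  obtain ⟨V', hVo', hmV', hV1', hV2', hV3'⟩ := key m O' E hO' hmO' (h2 ▸ E'.param_mem _)
    (fun h => Set.disjoint_left.1 hd h ⟨-t, h2.symm⟩)
  have hopen : IsOpenMap T.proj := hcov.isLocalHomeomorph.isOpenMap
  have hC : IsClosed (E.param '' {s | E'.param (-s) ∉ T.proj '' V'}) := by
    refine E.isClosedEmbedding.isClosedMap _ (IsOpen.isClosed_compl (s := {s | E'.param (-s) ∈ T.proj '' V'}) ?_)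
    exact (hopen _ hVo').preimage (E'.continuous.comp continuous_neg)
  have hC' : IsClosed ((fun s => E'.param (-s)) '' {s | E.param s ∉ T.proj '' V}) := by
    refine (E'.isClosedEmbedding.comp (Homeomorph.neg ℝ).isClosedEmbedding).isClosedMap _
      (IsOpen.isClosed_compl (s := {s | E.param s ∈ T.proj '' V}) ?_)
    exact (hopen _ hVo).preimage E.continuous
  refine ⟨(V ∩ T.proj ⁻¹' (E.param '' {s | E'.param (-s) ∉ T.proj '' V'})ᶜ) ∪
    (V' ∩ T.proj ⁻¹' ((fun s => E'.param (-s)) '' {s | E.param s ∉ T.proj '' V})ᶜ),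
    (hVo.inter (hC.isOpen_compl.preimage hcov.continuous)).union
      (hVo'.inter (hC'.isOpen_compl.preimage hcov.continuous)), ?_, ?_, ?_, ?_⟩
  · refine .inl ⟨hlV, ?_⟩
    rintro ⟨s, hs, hs'⟩
    have := E.injective (hs'.trans h1)
    subst this
    exact hs ⟨m, hmV', h2⟩
  · refine .inr ⟨hmV', ?_⟩
    rintro ⟨s, hs, hs'⟩
    have := neg_injective (E'.injective (hs'.trans h2))
    subst this
    exact hs ⟨l, hlV, h1⟩
  · rintro x y ⟨s, hx, hy, hxy⟩
    constructor
    · rintro (⟨hxV, hxC⟩ | ⟨hxV, -⟩)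
      · have h4 : E'.param (-s) ∈ T.proj '' V' := by
          by_contra h
          exact hxC ⟨s, h, hx.symm⟩
        obtain ⟨y0, hy0, hy0'⟩ := h4
        have h5 : y = y0 := by
          refine T.frame_unique (hy.trans hy0'.symm) (hy ▸ E'.param_mem _)
            (Pinning.opp_injective ?_)
          rw [← hxy, hV2 x hxV (hx ▸ E.param_mem _), hV2' y0 hy0 (hy0' ▸ E'.param_mem _), h3]
        subst h5
        refine .inr ⟨hy0, ?_⟩
        rintro ⟨s', hs', hs''⟩
        have := neg_injective (E'.injective (hs''.trans hy))
        subst this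
        exact hs' ⟨x, hxV, hx⟩
      · exact absurd ⟨s, hx.symm⟩ (hV1' x hxV).2
    · rintro (⟨hyV, -⟩ | ⟨hyV, hyC⟩)
      · exact absurd ⟨-s, hy.symm⟩ (hV1 y hyV).2
      · have h4 : E.param s ∈ T.proj '' V := by
          by_contra h
          exact hyC ⟨s, h, hy.symm⟩
        obtain ⟨x0, hx0, hx0'⟩ := h4
        have h5 : x = x0 := by
          refine T.frame_unique (hx.trans hx0'.symm) (hx ▸ E.param_mem _) ?_
          rw [hxy, hV2' y hyV (hy ▸ E'.param_mem _), hV2 x0 hx0 (hx0' ▸ E.param_mem _), h3]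
        subst h5
        refine .inl ⟨hx0, ?_⟩
        rintro ⟨s', hs', hs''⟩
        have := E.injective (hs''.trans hx)
        subst this
        exact hs' ⟨y, hyV, hy⟩
  · rintro g x (⟨hx, -⟩ | ⟨hx, -⟩) (⟨hgx, -⟩ | ⟨hgx, -⟩)
    · exact hV3 g x hx hgx
    · have := (hV1' _ hgx).1
      rw [T.proj_smul] at this
      exact (Set.disjoint_left.1 hOO' (hV1 x hx).1 this).elim
    · have := (hV1 _ hgx).1
      rw [T.proj_smul] at this
      exact (Set.disjoint_left.1 hOO' this (hV1' x hx).1).elim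
    · exact hV3' g x hx hgx

lemma exists_matched_right {l : T.total} (hl : T.proj l ∈ E.set) : ∃ m, Matched E E' T l m := by
  obtain ⟨t, ht⟩ := hl
  obtain ⟨q, hq⟩ := Pinning.opp_surjective (T.p l)
  obtain ⟨m, h1, h2⟩ := T.exists_frame (E'.param_mem (-t)) q
  exact ⟨m, t, ht.symm, h1, by rw [h2, hq]⟩

lemma exists_matched_left {m : T.total} (hm : T.proj m ∈ E'.set) : ∃ l, Matched E E' T l m := by
  obtain ⟨t, ht⟩ := hm
  obtain ⟨l, h1, h2⟩ := T.exists_frame (E.param_mem (-t)) (T.p m).opp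
  exact ⟨l, -t, h1, by rw [neg_neg, ht], h2⟩

theorem isQuotientCoveringMap_glueProj : IsQuotientCoveringMap (P.glueProj T) Gᵐᵒᵖ where
  toIsQuotientMap := by
    have h : IsQuotientMap (P.glueProj T ∘ P.glueMk T) :=
      P.isQuotientMap_mapP.comp T.isCovering.toIsQuotientMap
    refine IsQuotientMap.of_comp (P.isQuotientMap_glueMk T).continuous ?_ h
    exact (P.isQuotientMap_glueMk T).continuous_iff.2 h.continuous
  continuous_const_smul g := by
    have := T.isCovering.toContinuousConstSMul
    refine (P.isQuotientMap_glueMk T).continuous_iff.2 ?_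
    exact (P.isQuotientMap_glueMk T).continuous.comp (continuous_const_smul g)
  apply_eq_iff_mem_orbit {q q'} := by
    obtain ⟨l, rfl⟩ := P.glueMk_surjective T q
    obtain ⟨m, rfl⟩ := P.glueMk_surjective T q'
    constructor
    · intro h
      rcases P.mapP_eq h with h | ⟨t, ⟨h1, h2⟩ | ⟨h1, h2⟩⟩
      · obtain ⟨g, hg⟩ := T.isCovering.apply_eq_iff_mem_orbit.1 h
        exact ⟨g, congrArg (P.glueMk T) hg⟩
      · obtain ⟨n, hn⟩ := exists_matched_left (E := E) T (m := m) ⟨-t, h2.symm⟩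
        obtain ⟨s, hs1, hs2, -⟩ := id hn
        have := neg_injective (E'.injective (hs2.symm.trans h2))
        subst this
        obtain ⟨g, hg⟩ := T.isCovering.apply_eq_iff_mem_orbit.1 (h1.trans hs1.symm)
        refine ⟨g, ?_⟩
        rw [← P.glueMk_eq.2 (.inr (.inl hn))]
        exact congrArg (P.glueMk T) hg
      · obtain ⟨n, hn⟩ := exists_matched_right (E' := E') T (l := m) ⟨t, h1.symm⟩
        obtain ⟨s, hs1, hs2, -⟩ := id hn
        have := E.injective (hs1.symm.trans h1)
        subst this
        obtain ⟨g, hg⟩ := T.isCovering.apply_eq_iff_mem_orbit.1 (h2.trans hs2.symm)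
        refine ⟨g, ?_⟩
        rw [P.glueMk_eq.2 (.inr (.inl hn))]
        exact congrArg (P.glueMk T) hg
    · rintro ⟨g, hg⟩
      rw [← hg]
      exact congrArg P.mapP (T.proj_smul g m)
  disjoint q := by
    obtain ⟨l, rfl⟩ := P.glueMk_surjective T q
    have hcov : IsCoveringMap T.proj := T.isCovering.isCoveringMap
    obtain ⟨W, hW, hlW, hsat, hfree⟩ : ∃ W : Set T.total, IsOpen W ∧ l ∈ W ∧
        (∀ x y, Matched E E' T x y → (x ∈ W ↔ y ∈ W)) ∧
        ∀ (g : Gᵐᵒᵖ) x, x ∈ W → g • x ∈ W → g = 1 := by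
      by_cases h : T.proj l ∈ E.set
      · obtain ⟨m, hm⟩ := exists_matched_right (E' := E') T h
        obtain ⟨W, h1, h2, -, h3⟩ := exists_free P.disjoint hm
        exact ⟨W, h1, h2, h3⟩
      by_cases h' : T.proj l ∈ E'.set
      · obtain ⟨m, hm⟩ := exists_matched_left (E := E) T h'
        obtain ⟨W, h1, -, h2, h3⟩ := exists_free P.disjoint hm
        exact ⟨W, h1, h2, h3⟩
      obtain ⟨V0, hV0, hfree⟩ := T.isCovering.disjoint l
      obtain ⟨V, hV, hVo, hlV⟩ := mem_nhds_iff.1 hV0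
      refine ⟨V ∩ T.proj ⁻¹' (E.set ∪ E'.set)ᶜ, hVo.inter
        ((E.isClosed_set.union E'.isClosed_set).isOpen_compl.preimage hcov.continuous),
        ⟨hlV, fun h0 => h0.elim h h'⟩, ?_, ?_⟩
      · rintro x y ⟨t, h1, h2, -⟩
        exact ⟨fun hx => (hx.2 (.inl ⟨t, h1.symm⟩)).elim,
          fun hy => (hy.2 (.inr ⟨-t, h2.symm⟩)).elim⟩
      · exact fun g x hx hgx => hfree g ⟨g • x, ⟨x, hV hx.1, rfl⟩, hV hgx.1⟩
    have hpre : P.glueMk T ⁻¹' (P.glueMk T '' W) = W := by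
      refine subset_antisymm ?_ (subset_preimage_image _ _)
      rintro x ⟨y, hy, hxy⟩
      rcases P.glueMk_eq.1 hxy with rfl | h | h
      exacts [hy, (hsat _ _ h).1 hy, (hsat _ _ h).2 hy]
    refine ⟨P.glueMk T '' W, IsOpen.mem_nhds ?_ ⟨l, hlW, rfl⟩, ?_⟩
    · rw [← (P.isQuotientMap_glueMk T).isOpen_preimage, hpre]
      exact hW
    · rintro g ⟨_, ⟨_, ⟨x, hx, rfl⟩, rfl⟩, hgx⟩
      refine hfree g x hx ?_
      rw [← hpre]
      exact hgx

end Gluing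
end GlueSystem

section GlueSystemStructure
variable {G : Type u} [Group G] {D : FlagDatum G} {S S' : MarkedSurface.{u}}
  {E E' : S.BoundaryInterval} (P : Gluing S S' E E') (T : FramedSystem D S)
open MulOpposite

namespace Gluing

lemma rep_glueMk_eq {l : T.total} (h : P.mapP (T.proj l) ∈ S'.bdry) :
    P.rep T (P.glueMk T l) = l := by
  have h1 := P.mem_bdry_iff.1 h
  rcases P.glueMk_eq.1 (P.glueMk_rep T (P.glueMk T l)) with h | ⟨t, -, h2, -⟩ | ⟨t, h2, -, -⟩
  · exact h
  · exact absurd ⟨-t, h2.symm⟩ h1.2.2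
  · exact absurd ⟨t, h2.symm⟩ h1.2.1

/-- The framing agrees at matched points near the marked points. -/
lemma exists_framing_region : ∃ U : Set S.carrier, IsOpen U ∧ S.marked ⊆ U ∧
    (∀ l, (T.proj l).1 ∈ U → (∀ g : G, T.β (op g • l) = g⁻¹ • T.β l) ∧
      ∀ᶠ l' in 𝓝 l, T.β l' = T.β l) ∧
    ∀ l m, Matched E E' T l m → (T.proj l).1 ∈ U → (T.proj m).1 ∈ U → T.β l = T.β m := by
  obtain ⟨U, hU, hm, hUβ⟩ := T.framing
  obtain ⟨h1, h2⟩ := T.compat E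
  obtain ⟨h1', h2'⟩ := T.compat E'
  obtain ⟨a, ha⟩ := eventually_atBot.1 h1
  obtain ⟨c, hc⟩ := eventually_atTop.1 h2
  obtain ⟨a', ha'⟩ := eventually_atBot.1 h1'
  obtain ⟨c', hc'⟩ := eventually_atTop.1 h2'
  have hK : IsClosed ((fun t => (E.param t).1) '' Icc (min a (-c')) (max c (-a'))) :=
    (isCompact_Icc.image (continuous_subtype_val.comp E.continuous)).isClosed
  refine ⟨U \ (fun t => (E.param t).1) '' Icc (min a (-c')) (max c (-a')), hU.sdiff hK,
    fun x hx => ⟨hm hx, ?_⟩, fun l hl => hUβ l hl.1, ?_⟩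
  · rintro ⟨t, -, rfl⟩
    exact (E.param t).2 hx
  · rintro l m ⟨t, hl, hm, hp⟩ hlU -
    have ht : t ∉ Icc (min a (-c')) (max c (-a')) := fun h => hlU.2 ⟨t, h, by rw [hl]⟩
    rw [mem_Icc, not_and_or, not_le, not_le, lt_min_iff, max_lt_iff] at ht
    rcases ht with ⟨h3, h4⟩ | ⟨h3, h4⟩
    · rw [← ha t h3.le l hl, ← hc' (-t) (by linarith) m hm, hp, Pinning.fst_opp]
    · rw [← hc t h3.le l hl, ← ha' (-t) (by linarith) m hm, hp, Pinning.snd_opp]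

lemma exists_rep_region : ∃ U' : Set S'.carrier, IsOpen U' ∧ S'.marked ⊆ U' ∧
    ∀ l, P.map (T.proj l).1 ∈ U' → (∀ g : G, T.β (op g • l) = g⁻¹ • T.β l) ∧
      (∀ᶠ l' in 𝓝 l, T.β l' = T.β l) ∧ T.β (P.rep T (P.glueMk T l)) = T.β l := by
  obtain ⟨U, hU, hm, hUβ, hUm⟩ := exists_framing_region (E := E) (E' := E') T
  obtain ⟨U', hU', hm', hUU'⟩ := P.exists_region hU hm
  refine ⟨U', hU', hm', fun l hl => ?_⟩
  have hl' := hUU' _ hl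
  refine ⟨(hUβ l hl').1, (hUβ l hl').2, ?_⟩
  have h0 := P.glueMk_rep T (P.glueMk T l)
  have hr : (T.proj (P.rep T (P.glueMk T l))).1 ∈ U := by
    refine hUU' _ ?_
    have : P.mapP (T.proj (P.rep T (P.glueMk T l))) = P.mapP (T.proj l) :=
      congrArg (P.glueProj T) h0
    have h1 : P.map (T.proj (P.rep T (P.glueMk T l))).1 = P.map (T.proj l).1 :=
      congrArg Subtype.val this
    rwa [h1]
  rcases P.glueMk_eq.1 h0 with h | h | h
  · rw [h]
  · exact hUm _ _ h hr hl'
  · exact (hUm _ _ h hl' hr).symm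

/-- The framed local system with pinnings on `S'` obtained by gluing: the unique isomorphism between
the restrictions to `E` and `E'` which identifies `p_E` with `p_{E'}^*` glues the local system. -/
def glueSystem : FramedSystem D S' where
  total := P.GlueTotal T
  proj := P.glueProj T
  isCovering := P.isQuotientCoveringMap_glueProj T
  β q := T.β (P.rep T q)
  p q := T.p (P.rep T q)
  framing := by
    obtain ⟨U', hU', hm', hβ⟩ := P.exists_rep_region T
    have hcov : IsCoveringMap T.proj := T.isCovering.isCoveringMap
    refine ⟨U', hU', hm', fun q hq => ?_⟩
    obtain ⟨l, rfl⟩ := P.glueMk_surjective T q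
    have h1 := hβ l hq
    refine ⟨fun g => ?_, ?_⟩
    · have h2 := hβ (op g • l) (by
        rw [T.proj_smul]
        exact hq)
      rw [smul_glueMk, h2.2.2, h1.2.2, h1.1]
    · have hN : IsOpen {q : P.GlueTotal T | (P.glueProj T q).1 ∈ U' ∧
          T.β (P.rep T q) = T.β (P.rep T (P.glueMk T l))} := by
        rw [← (P.isQuotientMap_glueMk T).isOpen_preimage, isOpen_iff_mem_nhds]
        rintro m ⟨hm1, hm2⟩
        have hcont : Continuous fun m => P.map (T.proj m).1 :=
          P.continuous_map.comp (continuous_subtype_val.comp hcov.continuous)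
        filter_upwards [(hβ m hm1).2.1, hcont.continuousAt.eventually (hU'.mem_nhds hm1)]
          with m' h3 h4
        refine ⟨h4, ?_⟩
        rw [(hβ m' h4).2.2, h3, ← (hβ m hm1).2.2, hm2]
      filter_upwards [hN.mem_nhds ⟨hq, rfl⟩] with q' hq'
      exact hq'.2
  p_smul q hq g := by
    obtain ⟨l, rfl⟩ := P.glueMk_surjective T q
    rw [smul_glueMk, P.rep_glueMk_eq T hq, P.rep_glueMk_eq T (by
      rw [T.proj_smul]
      exact hq), T.p_smul l (P.mem_bdry_iff.1 hq).1]
  p_const q hq := by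
    obtain ⟨l, rfl⟩ := P.glueMk_surjective T q
    have hcov : IsCoveringMap T.proj := T.isCovering.isCoveringMap
    have hN : IsOpen {q : P.GlueTotal T | P.glueProj T q ∈ S'.bdry →
        T.p (P.rep T q) = T.p (P.rep T (P.glueMk T l))} := by
      rw [← (P.isQuotientMap_glueMk T).isOpen_preimage, isOpen_iff_mem_nhds]
      intro m hm
      by_cases h : P.mapP (T.proj m) ∈ S'.bdry
      · filter_upwards [T.p_const m (P.mem_bdry_iff.1 h).1] with m' hm' h'
        rw [P.rep_glueMk_eq T h', hm' (P.mem_bdry_iff.1 h').1, ← P.rep_glueMk_eq T h]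
        exact hm h
      · have hcont : Continuous fun m => P.mapP (T.proj m) := P.continuous_mapP.comp hcov.continuous
        filter_upwards [hcont.continuousAt.eventually
          (S'.isClosed_bdry.isOpen_compl.mem_nhds h)] with m' hm' h'
        exact absurd h' hm'
    exact hN.mem_nhds fun _ => rfl
  compat F := by
    choose e he using fun t => P.surjective_mapP (F.param t)
    have he' : ∀ t, e t ∉ E.set ∧ e t ∉ E'.set := fun t =>
      (P.mem_bdry_iff.1 (by rw [he]; exact F.param_mem t)).2
    let F' : S.BoundaryInterval := ⟨e, (P.oriented_iff e F.param he' fun t =>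
      congrArg Subtype.val (he t).symm).2 F.isOriented⟩
    have key : ∀ t q, P.glueProj T q = F.param t → ∃ l, T.proj l = F'.param t ∧ P.rep T q = l := by
      intro t q hq
      obtain ⟨l, rfl⟩ := P.glueMk_surjective T q
      have hb : P.mapP (T.proj l) ∈ S'.bdry := by
        rw [← P.glueProj_glueMk, hq]
        exact F.param_mem t
      refine ⟨l, ?_, P.rep_glueMk_eq T hb⟩
      rcases P.mapP_eq (hq.trans (he t).symm) with h | ⟨s, ⟨-, h⟩ | ⟨h, -⟩⟩
      · exact h
      · exact absurd ⟨-s, h.symm⟩ (he' t).2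
      · exact absurd ⟨s, h.symm⟩ (he' t).1
    refine ⟨?_, ?_⟩
    · filter_upwards [(T.compat F').1] with t ht q hq
      obtain ⟨l, hl, hr⟩ := key t q hq
      rw [hr]
      exact ht l hl
    · filter_upwards [(T.compat F').2] with t ht q hq
      obtain ⟨l, hl, hr⟩ := key t q hq
      rw [hr]
      exact ht l hl

variable {T} in
lemma Matched.map {T' : FramedSystem D S} (F : FramedIso T T') {l m : T.total}
    (h : Matched E E' T l m) : Matched E E' T' (F.toHomeomorph l) (F.toHomeomorph m) := by
  obtain ⟨t, h1, h2, h3⟩ := h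
  refine ⟨t, by rw [F.proj_eq, h1], by rw [F.proj_eq, h2], ?_⟩
  rw [F.p_eq _ (h1 ▸ E.param_mem t), F.p_eq _ (h2 ▸ E'.param_mem _), h3]

variable {T} in
/-- The map between the glued total spaces. -/
def glueFun {T' : FramedSystem D S} (F : FramedIso T T') : P.GlueTotal T → P.GlueTotal T' :=
  Quotient.map F.toHomeomorph (by
    rintro l m (rfl | h | h)
    exacts [.inl rfl, .inr (.inl (h.map F)), .inr (.inr (h.map F))])

variable {T} in
lemma glueFun_glueMk {T' : FramedSystem D S} (F : FramedIso T T') (l : T.total) :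
    P.glueFun F (P.glueMk T l) = P.glueMk T' (F.toHomeomorph l) := rfl

variable {T} in
lemma continuous_glueFun {T' : FramedSystem D S} (F : FramedIso T T') :
    Continuous (P.glueFun F) :=
  (P.isQuotientMap_glueMk T).continuous_iff.2
    ((P.isQuotientMap_glueMk T').continuous.comp F.toHomeomorph.continuous)

variable {T} in
/-- Isomorphic systems have isomorphic gluings. -/
def glueIso {T' : FramedSystem D S} (F : FramedIso T T') :
    FramedIso (P.glueSystem T) (P.glueSystem T') where
  toHomeomorph :=
    { toFun := P.glueFun F
      invFun := P.glueFun F.symm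
      left_inv := fun q => by
        obtain ⟨l, rfl⟩ := P.glueMk_surjective T q
        rw [glueFun_glueMk, glueFun_glueMk]
        exact congrArg _ (F.toHomeomorph.symm_apply_apply l)
      right_inv := fun q => by
        obtain ⟨l, rfl⟩ := P.glueMk_surjective T' q
        rw [glueFun_glueMk, glueFun_glueMk]
        exact congrArg _ (F.toHomeomorph.apply_symm_apply l)
      continuous_toFun := P.continuous_glueFun F
      continuous_invFun := P.continuous_glueFun F.symm }
  map_smul g q := by
    obtain ⟨l, rfl⟩ := P.glueMk_surjective T q
    exact congrArg (P.glueMk T') (F.map_smul g l)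
  proj_eq q := by
    obtain ⟨l, rfl⟩ := P.glueMk_surjective T q
    exact congrArg P.mapP (F.proj_eq l)
  β_eq := by
    obtain ⟨U, hU, hm, hF⟩ := F.β_eq
    obtain ⟨U0, hU0, hm0, h0⟩ := P.exists_region hU hm
    obtain ⟨U1, hU1, hm1, h1⟩ := P.exists_rep_region T
    obtain ⟨U2, hU2, hm2, h2⟩ := P.exists_rep_region T'
    refine ⟨U0 ∩ (U1 ∩ U2), hU0.inter (hU1.inter hU2), subset_inter hm0 (subset_inter hm1 hm2), ?_⟩
    intro q hq
    obtain ⟨l, rfl⟩ := P.glueMk_surjective T q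
    have e1 := (h1 l hq.2.1).2.2
    have e2 := (h2 (F.toHomeomorph l) (by
      rw [F.proj_eq]
      exact hq.2.2)).2.2
    exact e2.trans ((hF l (h0 _ hq.1)).trans e1.symm)
  p_eq q hq := by
    obtain ⟨l, rfl⟩ := P.glueMk_surjective T q
    have e1 := P.rep_glueMk_eq T hq
    have e2 := P.rep_glueMk_eq T' (l := F.toHomeomorph l) (by
      rw [F.proj_eq]
      exact hq)
    change T'.p (P.rep T' (P.glueMk T' (F.toHomeomorph l))) = T.p (P.rep T (P.glueMk T l))
    rw [e1, e2]
    exact F.p_eq l (P.mem_bdry_iff.1 hq).1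

variable (D) in
/-- The gluing morphism `q_{E,E'} : 𝒫_{G,Σ} → 𝒫_{G,Σ'}`. -/
def glueModuli : Moduli D S → Moduli D S' :=
  Quotient.map P.glueSystem fun _ _ ⟨F⟩ => ⟨P.glueIso F⟩

/-- The boundary interval of the glued surface which is the image of a boundary interval different
from the glued ones. -/
def interval (F : S.BoundaryInterval) (hF : Disjoint F.set E.set) (hF' : Disjoint F.set E'.set) :
    S'.BoundaryInterval where
  param t := P.mapP (F.param t)
  isOriented := (P.oriented_iff F.param _ (fun t =>
    ⟨fun h => Set.disjoint_left.1 hF ⟨t, rfl⟩ h, fun h => Set.disjoint_left.1 hF' ⟨t, rfl⟩ h⟩)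
      fun _ => rfl).1 F.isOriented

lemma mem_interval {F : S.BoundaryInterval} {hF : Disjoint F.set E.set}
    {hF' : Disjoint F.set E'.set} {x : S.Punctured} (hx : x ∈ F.set) :
    P.mapP x ∈ (P.interval F hF hF').set := by
  obtain ⟨t, rfl⟩ := hx
  exact ⟨t, rfl⟩

end Gluing
end GlueSystemStructure

section Concatenation
variable {S S' : MarkedSurface.{u}} {E₁ E₂ E₂' E₃ : S.BoundaryInterval}

/-- The coordinate of a point of a boundary interval. -/
def MarkedSurface.BoundaryInterval.coord (E : S.BoundaryInterval) (x : E.set) : ℝ :=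
  E.isOriented.isEmbedding.toHomeomorph.symm x

lemma MarkedSurface.BoundaryInterval.continuous_coord (E : S.BoundaryInterval) :
    Continuous E.coord := E.isOriented.isEmbedding.toHomeomorph.symm.continuous

lemma MarkedSurface.BoundaryInterval.param_coord (E : S.BoundaryInterval) (x : E.set) :
    E.param (E.coord x) = x :=
  congrArg Subtype.val (E.isOriented.isEmbedding.toHomeomorph.apply_symm_apply x)

namespace Gluing
variable (P : Gluing S S' E₂ E₂')

/-- The image of the first path in the glued surface. -/
def firstPath (γ : Arc E₁ E₂) : Path (P.mapP (γ.1 0)) (P.mapP (γ.1 1)) where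
  toFun t := P.mapP (γ.1 t)
  continuous_toFun := P.continuous_mapP.comp γ.1.continuous
  source' := rfl
  target' := rfl

/-- The image of the second path in the glued surface. -/
def lastPath (γ : Arc E₂' E₃) : Path (P.mapP (γ.1 0)) (P.mapP (γ.1 1)) where
  toFun t := P.mapP (γ.1 t)
  continuous_toFun := P.continuous_mapP.comp γ.1.continuous
  source' := rfl
  target' := rfl

/-- The path inside the common image of `E₂` and `E₂'` from the endpoint of the first path to the
starting point of the second path. -/
def slidePath (γ₁ : Arc E₁ E₂) (γ₂ : Arc E₂' E₃) :
    Path (P.mapP (γ₁.1 1)) (P.mapP (γ₂.1 0)) where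
  toFun t := P.mapP (E₂.param
    ((1 - t) * E₂.coord ⟨_, γ₁.2.2⟩ + t * -E₂'.coord ⟨_, γ₂.2.1⟩))
  continuous_toFun := P.continuous_mapP.comp (E₂.continuous.comp (by fun_prop))
  source' := by simp [E₂.param_coord]
  target' := by simp [P.mapP_glue, E₂'.param_coord]

/-- The concatenation of two paths in the glued surface, where the second path starts on `E₂'` and
the first one ends on `E₂`. -/
def concatPath (γ₁ : Arc E₁ E₂) (γ₂ : Arc E₂' E₃) :
    Path (P.mapP (γ₁.1 0)) (P.mapP (γ₂.1 1)) :=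
  ((P.firstPath γ₁).trans (P.slidePath γ₁ γ₂)).trans (P.lastPath γ₂)

lemma continuous_concatPath {X : Type*} [TopologicalSpace X] {γ₁ : X → Arc E₁ E₂}
    {γ₂ : X → Arc E₂' E₃} (h₁ : Continuous fun x : X × I => (γ₁ x.1).1 x.2)
    (h₂ : Continuous fun x : X × I => (γ₂ x.1).1 x.2) :
    Continuous fun x : X × I => P.concatPath (γ₁ x.1) (γ₂ x.1) x.2 := by
  have c₁ : Continuous fun x : X => E₂.coord ⟨_, (γ₁ x).2.2⟩ :=
    E₂.continuous_coord.comp (Continuous.subtype_mk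
      (h₁.comp (continuous_id.prodMk continuous_const) : Continuous fun x => (γ₁ x).1 1) _)
  have c₂ : Continuous fun x : X => E₂'.coord ⟨_, (γ₂ x).2.1⟩ :=
    E₂'.continuous_coord.comp (Continuous.subtype_mk
      (h₂.comp (continuous_id.prodMk continuous_const) : Continuous fun x => (γ₂ x).1 0) _)
  refine Path.trans_continuous_family _ (Path.trans_continuous_family
    (fun x => P.firstPath (γ₁ x)) ?_ (fun x => P.slidePath (γ₁ x) (γ₂ x)) ?_)
    (fun x => P.lastPath (γ₂ x)) ?_
  · exact P.continuous_mapP.comp h₁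
  · refine P.continuous_mapP.comp (E₂.continuous.comp ?_)
    have d₁ := c₁.comp (continuous_fst (X := X) (Y := I))
    have d₂ := c₂.comp (continuous_fst (X := X) (Y := I))
    exact ((continuous_const.sub (continuous_subtype_val.comp continuous_snd)).mul d₁).add
      ((continuous_subtype_val.comp continuous_snd).mul d₂.neg)
  · exact P.continuous_mapP.comp h₂

variable (h₁ : Disjoint E₁.set E₂.set) (h₁' : Disjoint E₁.set E₂'.set)
  (h₃ : Disjoint E₃.set E₂.set) (h₃' : Disjoint E₃.set E₂'.set)

/-- The concatenation, as a path between boundary intervals of the glued surface. -/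
def concatArc (γ₁ : Arc E₁ E₂) (γ₂ : Arc E₂' E₃) :
    Arc (P.interval E₁ h₁ h₁') (P.interval E₃ h₃ h₃') :=
  ⟨(P.concatPath γ₁ γ₂).toContinuousMap, by
    constructor
    · change P.concatPath γ₁ γ₂ 0 ∈ _
      rw [Path.source]
      exact P.mem_interval γ₁.2.1
    · change P.concatPath γ₁ γ₂ 1 ∈ _
      rw [Path.target]
      exact P.mem_interval γ₂.2.2⟩

/-- The concatenation `[c] : E₁ → E₃` of the arc classes `[c₁] : E₁ → E₂` and
`[c₂] : E₂' → E₃`. -/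
def concat (c₁ : ArcClass E₁ E₂) (c₂ : ArcClass E₂' E₃) :
    ArcClass (P.interval E₁ h₁ h₁') (P.interval E₃ h₃ h₃') :=
  Quotient.map₂ (P.concatArc h₁ h₁' h₃ h₃') (by
    rintro γ₁ γ₁' ⟨K₁⟩ γ₂ γ₂' ⟨K₂⟩
    let k₁ : I → Arc E₁ E₂ := fun s => ⟨K₁.toHomotopy.curry s, K₁.prop s⟩
    let k₂ : I → Arc E₂' E₃ := fun s => ⟨K₂.toHomotopy.curry s, K₂.prop s⟩
    have hk₁0 : k₁ 0 = γ₁ := Subtype.ext (ContinuousMap.ext fun t => K₁.apply_zero t)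
    have hk₁1 : k₁ 1 = γ₁' := Subtype.ext (ContinuousMap.ext fun t => K₁.apply_one t)
    have hk₂0 : k₂ 0 = γ₂ := Subtype.ext (ContinuousMap.ext fun t => K₂.apply_zero t)
    have hk₂1 : k₂ 1 = γ₂' := Subtype.ext (ContinuousMap.ext fun t => K₂.apply_one t)
    refine ⟨{
      toFun := fun x => P.concatArc h₁ h₁' h₃ h₃' (k₁ x.1) (k₂ x.1) |>.1 x.2
      continuous_toFun := P.continuous_concatPath (γ₁ := k₁) (γ₂ := k₂) K₁.continuous K₂.continuous
      map_zero_left := fun t => ?_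
      map_one_left := fun t => ?_
      prop' := fun s => (P.concatArc h₁ h₁' h₃ h₃' (k₁ s) (k₂ s)).2 }⟩
    · simp only [hk₁0, hk₂0]
    · simp only [hk₁1, hk₂1]) c₁ c₂

end Gluing
end Concatenation

end

end WilsonLines

open WilsonLines

namespace WilsonLines

open Set Filter Topology MulOpposite
open scoped unitInterval

/-! The Wilson line compares the pinnings at the two ends of a path in one flat frame, so
multiplicativity amounts to finding one flat frame along the concatenated path in the glued system.
A point of the total space of a local system is a frame of a fibre. The function `p` reads off the
pinning in that frame, and changing the frame by `g` on the right changes the reading by `g⁻¹`. Take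
a lift `Γ₁` of the first path that starts at `p_std` and ends at `g₁ . p_std^*`, and a lift `Γ₂` of
the second that starts at `p_std` and ends at `g₂ . p_std^*`.

The gluing joins a frame over `E₂` to a frame over `E₂'` exactly when the first pinning is the
opposite of the second. Translating `Γ₂` so that its readings are multiplied by `g₁` makes it start
at `g₁ . p_std`. The opposite of that pinning is `g₁ . p_std^*`, because taking opposites is
equivariant, and this is the reading at the end of `Γ₁`. The two lifts therefore fit together in the
glued total space, and the combined lift starts at `p_std` and ends at `g₁ . (g₂ . p_std^*)`, which
gives `g₁ g₂`.

One adjustment remains. The end of the first path and the start of the second need not be identified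
points, so a path inside `E₂` is inserted between them. The pinning is flat along the boundary
interval, so the reading does not change on the way (`FramedSystem.exists_lift_of_bdry`). At the two
outer ends nothing is glued, and the pinning of the glued system is the old one
(`glueSystem_p_glueMk`). The frame itself is built in `isWilson_concatArc`, and
`existsUnique_isWilson` identifies its value with the Wilson line.

Of the group, only the following is used: pinnings form a principal `G`-set, and the opposite map
commutes with `G`. In particular `*` need not be an involution. No connectedness enters either, so
gluing two components and gluing a component to itself are one case. -/

/-- A map sending two paths to two other paths sends concatenation to concatenation. -/
lemma apply_path_trans {X Y : Type*} [TopologicalSpace X] [TopologicalSpace Y] {f : X → Y}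
    {a b c : X} {a' b' c' : Y} {α : Path a b} {β : Path b c} {α' : Path a' b'} {β' : Path b' c'}
    (hα : ∀ t, f (α t) = α' t) (hβ : ∀ t, f (β t) = β' t) (t : I) :
    f (α.trans β t) = α'.trans β' t := by
  -- Both concatenations switch pieces at the same parameter `1/2`, so one case distinction settles
  -- both sides.
  rw [Path.trans_apply, Path.trans_apply]
  split_ifs
  exacts [hα _, hβ _]

/-! ### Parallel transport of frames along the boundary -/

section
variable {G : Type u} [Group G] {D : FlagDatum G} {S S' : MarkedSurface.{u}}

/-- A path in a boundary interval lifts to a path along which the pinning is constant. -/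
lemma FramedSystem.exists_lift_of_bdry (T : FramedSystem D S) (slide : C(I, S.Punctured))
    (hs : ∀ t, slide t ∈ S.bdry) {l : T.total} (hl : slide 0 = T.proj l) :
    ∃ Γ : C(I, T.total), (∀ t, T.proj (Γ t) = slide t) ∧ Γ 0 = l ∧ T.p (Γ 1) = T.p l := by
  obtain ⟨Γ, h1, h2⟩ := T.isCovering.isCoveringMap.exists_path_lifts slide l hl
  have h3 : ∀ t, T.proj (Γ t) = slide t := congrFun h1
  refine ⟨Γ, h3, h2, ?_⟩
  -- Flatness of `p` is available only over the boundary, which is why the whole path, and not just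
  -- its ends, has to lie there.
  rw [T.p_path Γ (fun t => h3 t ▸ hs t) 1, h2]

/-! ### Lifts to the glued local system and their Wilson lines -/

namespace Gluing
variable {E₁ E₂ E₂' E₃ : S.BoundaryInterval} (P : Gluing S S' E₂ E₂') (T : FramedSystem D S)

/-- The path in the glued total space which is the image of a path in the total space. -/
def glueMkPath (Γ : C(I, T.total)) {q q' : P.GlueTotal T} (h₀ : P.glueMk T (Γ 0) = q)
    (h₁ : P.glueMk T (Γ 1) = q') : Path q q' where
  -- The endpoints `q`, `q'` are free parameters because two lifts whose ends differ upstairs, but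
  -- are identified by the gluing, must become composable as paths.
  toFun t := P.glueMk T (Γ t)
  continuous_toFun := (P.isQuotientMap_glueMk T).continuous.comp Γ.continuous
  source' := h₀
  target' := h₁

/-- The pinning of the glued system over a boundary interval which is not glued. -/
lemma glueSystem_p_glueMk {F : S.BoundaryInterval} (hF : Disjoint F.set E₂.set)
    (hF' : Disjoint F.set E₂'.set) {l : T.total} (hl : T.proj l ∈ F.set) :
    (P.glueSystem T).p (P.glueMk T l) = T.p l :=
  -- The pinning of the glued system is read at a chosen representative. Away from the two glued
  -- intervals each class is a single frame, so the representative is `l` itself.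
  congrArg T.p <| P.rep_glueMk_eq T <| P.mem_bdry_iff.2
    ⟨F.set_subset hl, disjoint_left.1 hF hl, disjoint_left.1 hF' hl⟩

/-- This is the geometric heart: an explicit flat frame along the concatenated path, made of the
first lift, a transport inside `E₂`, and the second lift translated by `g₁⁻¹`. The factor `g₁`
stands on the left because the translation multiplies every boundary reading of the second lift by
`g₁` from the left. -/
theorem isWilson_concatArc (h₁ : Disjoint E₁.set E₂.set) (h₁' : Disjoint E₁.set E₂'.set)
    (h₃ : Disjoint E₃.set E₂.set) (h₃' : Disjoint E₃.set E₂'.set) {γ₁ : Arc E₁ E₂}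
    {γ₂ : Arc E₂' E₃} {g₁ g₂ : G} (w₁ : IsWilson T γ₁.1 g₁) (w₂ : IsWilson T γ₂.1 g₂) :
    IsWilson (P.glueSystem T) (P.concatArc h₁ h₁' h₃ h₃' γ₁ γ₂).1 (g₁ * g₂) := by
  obtain ⟨Γ₁, a₁, b₁, d₁⟩ := w₁
  obtain ⟨Γ₂, a₂, b₂, d₂⟩ := w₂
  -- Translations by group elements are continuous. The instance is found by `const_smul` in the
  -- next line.
  have := T.isCovering.toContinuousConstSMul
  -- The inverse compensates for the one in `p (op g • l) = g⁻¹ • p l`. After this change of frame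
  -- the starting pinning is `g₁ . p_std` instead of `p_std`.
  let Γ₃ : C(I, T.total) := ⟨fun t => op g₁⁻¹ • Γ₂ t, Γ₂.continuous.const_smul _⟩
  have a₃ : ∀ t, T.proj (Γ₃ t) = γ₂.1 t := fun t => (T.proj_smul _ _).trans (a₂ t)
  -- Equivariance of `p` holds only over the boundary. It is needed only at `t = 0`, over `E₂'`, and
  -- at `t = 1`, over `E₃`.
  have p₃ : ∀ t, γ₂.1 t ∈ S.bdry → T.p (Γ₃ t) = g₁ • T.p (Γ₂ t) := fun t ht => by
    have h := T.p_smul (Γ₂ t) (by rwa [a₂]) g₁⁻¹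
    rwa [inv_inv] at h
  -- Affine interpolation in the coordinate of `E₂`. The target coordinate carries a minus sign
  -- because the gluing identifies `E₂.param s` with `E₂'.param (-s)`. The formula is that of
  -- `slidePath`, so that the image of `slide` under `P.mapP` is `slidePath` by definition.
  let slide : C(I, S.Punctured) := ⟨fun t => E₂.param
    ((1 - t) * E₂.coord ⟨_, γ₁.2.2⟩ + t * -E₂'.coord ⟨_, γ₂.2.1⟩),
    E₂.continuous.comp (by fun_prop)⟩
  have hs0 : slide 0 = γ₁.1 1 := by simp [slide, E₂.param_coord]
  have hs1 : slide 1 = E₂.param (-E₂'.coord ⟨_, γ₂.2.1⟩) := by simp [slide]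
  -- The transport starts at the very frame where `Γ₁` stops, and it carries the pinning `g₁ .
  -- p_std^*` unchanged to the point of `E₂` that is glued to the start of the second path.
  obtain ⟨Δ, aΔ, Δ0, pΔ⟩ := T.exists_lift_of_bdry slide (fun t => E₂.param_mem _)
    (hs0.trans (a₁ 1).symm)
  -- The defining condition of the gluing isomorphism: the reading `g₁ . p_std^*` over `E₂` is the
  -- opposite of the reading `g₁ . p_std` over `E₂'`. This equality is what forces the translation
  -- by `g₁⁻¹`.
  have hmatch : Matched E₂ E₂' T (Δ 1) (Γ₃ 0) := by
    refine ⟨_, (aΔ 1).trans hs1, ?_, ?_⟩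
    · rw [a₃, neg_neg, E₂'.param_coord]
    · rw [pΔ, d₁, p₃ 0 (E₂'.set_subset γ₂.2.1), b₂, Pinning.opp_smul]
  -- The three lifts become composable in the quotient. `A` and `B` already meet upstairs, by `Δ0`.
  -- `B` and `C` meet only after gluing: upstairs `Δ 1` lies over `E₂` and `Γ₃ 0` over `E₂'`. The
  -- last alternative of `glueMk_eq` is taken because the equation to be proved has `Γ₃ 0` on its
  -- left.
  let A := P.glueMkPath T Γ₁ rfl rfl
  let B := P.glueMkPath T Δ (congrArg _ Δ0) rfl
  let C := P.glueMkPath T Γ₃ (P.glueMk_eq.2 (.inr (.inr hmatch))) rfl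
  -- The bracketing copies that of `concatPath`. With it the lift covers the concatenated path
  -- parameter by parameter, and no reparametrization is needed.
  refine ⟨((A.trans B).trans C).toContinuousMap, fun t => ?_, ?_, ?_⟩
  · exact apply_path_trans (f := P.glueProj T) (α := A.trans B) (β := C)
      (α' := (P.firstPath γ₁).trans (P.slidePath γ₁ γ₂)) (β' := P.lastPath γ₂)
      (apply_path_trans (fun t => congrArg P.mapP (a₁ t)) fun t => congrArg P.mapP (aΔ t))
      (fun t => congrArg P.mapP (a₃ t)) t
  -- The combined lift starts at the class of `Γ₁ 0`, a frame over `E₁`. This interval is disjoint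
  -- from the glued ones, so the reading is still `p_std`.
  · change (P.glueSystem T).p (((A.trans B).trans C) 0) = _
    rw [Path.source, P.glueSystem_p_glueMk T h₁ h₁' (by rw [a₁]; exact γ₁.2.1), b₁]
  -- At the other end the frame is the class of `Γ₃ 1` over `E₃`, with reading `g₁ . (g₂ .
  -- p_std^*)`.
  · change (P.glueSystem T).p (((A.trans B).trans C) 1) = _
    rw [Path.target, P.glueSystem_p_glueMk T h₃ h₃' (by rw [a₃]; exact γ₂.2.2),
      p₃ 1 (E₃.set_subset γ₂.2.2), d₂, mul_smul]

/-- Independence of the chosen paths and of the chosen local system is already built into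
`wilsonLine`, `concat` and `glueModuli`, so one representative of each class suffices. The result
holds for any `FlagDatum`; the Lie theory enters only through the construction of such a datum. -/
theorem wilsonLine_concat_glueModuli (h₁ : Disjoint E₁.set E₂.set)
    (h₁' : Disjoint E₁.set E₂'.set) (h₃ : Disjoint E₃.set E₂.set) (h₃' : Disjoint E₃.set E₂'.set)
    (c₁ : ArcClass E₁ E₂) (c₂ : ArcClass E₂' E₃) (x : Moduli D S) :
    wilsonLine (P.concat h₁ h₁' h₃ h₃' c₁ c₂) (P.glueModuli D x) =
      wilsonLine c₁ x * wilsonLine c₂ x := by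
  induction c₁ using Quotient.inductionOn with
  | h γ₁ =>
  induction c₂ using Quotient.inductionOn with
  | h γ₂ =>
  induction x using Quotient.inductionOn with
  | h T =>
  -- On representatives both sides are values of the Wilson line along the same arc in the same
  -- glued system: the left one by definition, the right one by the explicit lift. A lift is
  -- determined by its initial frame, and that frame by its pinning, so the values agree.
  exact (existsUnique_isWilson (P.glueSystem T) _).unique (FramedSystem.wilson_spec _ _)
    (P.isWilson_concatArc T h₁ h₁' h₃ h₃' (T.wilson_spec γ₁) (T.wilson_spec γ₂))

end Gluing
end

end WilsonLines

/-- The general gluing law applied to the datum `adjointDatum b hl` of the adjoint group. The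
Killing form condition required by that datum comes from semisimplicity in characteristic zero. The
Lie-theoretic content, namely that the pinnings are a principal homogeneous set and that `w̄₀`
exchanges the two underlying flags, is contained in the fields of the datum. -/
theorem proposition3p5 {ι : Type*} [Fintype ι] {𝔤 : Type u} [LieRing 𝔤] [LieAlgebra ℂ 𝔤]
    [FiniteDimensional ℂ 𝔤] [LieAlgebra.IsSemisimple ℂ 𝔤] {H : LieSubalgebra ℂ 𝔤}
    [H.IsCartanSubalgebra] (b : LieAlgebra.Basis ι H) {l : List ι} (hl : IsLongest b l)
    {S S' : MarkedSurface.{u}} {E₁ E₂ E₂' E₃ : S.BoundaryInterval} (P : Gluing S S' E₂ E₂')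
    (h₁ : Disjoint E₁.set E₂.set) (h₁' : Disjoint E₁.set E₂'.set)
    (h₃ : Disjoint E₃.set E₂.set) (h₃' : Disjoint E₃.set E₂'.set)
    (c₁ : ArcClass E₁ E₂) (c₂ : ArcClass E₂' E₃) (x : Moduli (adjointDatum b hl) S) :
    wilsonLine (P.concat h₁ h₁' h₃ h₃' c₁ c₂) (P.glueModuli (adjointDatum b hl) x) =
      wilsonLine c₁ x * wilsonLine c₂ x :=
  P.wilsonLine_concat_glueModuli h₁ h₁' h₃ h₃' c₁ c₂ x
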